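/- All graphs are finite, simple, undirected and unweighted. A graph $G$ is viewed as the (extended) metric space on $V(G)$ with its shortest-path distance $d_G$, where vertices in different connected components are at infinite distance. For an integer $n\ge 0$, a function $D:\mathbb{R}^+\to\mathbb{R}^+$ is an $n$-dimensional control function for $G$ if for every real $r>0$ there are families $\mathcal{U}_1,\dots,\mathcal{U}_{n+1}$ of subsets of $V(G)$ whose union covers $V(G)$, such that every set in every $\mathcal{U}_i$ has diameter at most $D(r)$, and any two points lying in different members of the same $\mathcal{U}_i$ are at distance greater than $r$. The asymptotic dimension of a class of graphs is the least $n$ for which a single function $D$ is an $n$-dimensional control function for every graph of the class (and $\infty$ if there is no such $n$). A layering of $G$ is a function $L:V(G)\to\mathbb{N}$ with $|L(u)-L(v)|\le 1$ for every edge $uv$; its layers are the sets $L^{-1}(j)$. A path-decomposition of $G$ is a finite path $P$ together with sets (bags) $B_x\subseteq V(G)$, $x\in V(P)$, such that for each vertex $v$ of $G$ the set $\{x : v\in B_x\}$ induces a non-empty subpath of $P$, and both ends of each edge of $G$ lie in a common bag. The graph $G$ has layered pathwidth at most $k$ if it has a path-decomposition and a layering such that each bag contains at most $k$ vertices of each layer.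 A graph $H$ is an apex-forest if $H-v$ is a forest for some $v\in V(H)$. **Corollary.** 1. For every integer $k\ge 0$, the class of graphs of layered pathwidth at most $k$ has asymptotic dimension at most $2$. 2. For every apex-forest $H$, the class of graphs that do not contain $H$ as a minor has asymptotic dimension at most $2$. -/

import Mathlib

open scoped NNReal ENNReal

universe u v w

namespace Asdim

/-- A family of subsets is `r`-disjoint if points of different members are at distance `> r`. -/
def RDisjoint {X : Type u} [EMetricSpace X] (r : ℝ≥0) (𝒰 : Set (Set X)) : Prop :=
  ∀ U ∈ 𝒰, ∀ U' ∈ 𝒰, U ≠ U' → ∀ a ∈ U, ∀ b ∈ U', (r : ℝ≥0∞) < edist a b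

/-- `D` is an `n`-dimensional control function for `X`: for every real `r > 0` there is a cover of
`X` which is a union of `n + 1` families, each of them `r`-disjoint and with all members of
diameter at most `D r`. Distances may be infinite (disconnected graphs). -/
def IsControlFunction (X : Type u) [EMetricSpace X] (n : ℕ) (D : ℝ≥0 → ℝ≥0) : Prop :=
  ∀ r : ℝ≥0, 0 < r → ∃ 𝒰 : Fin (n + 1) → Set (Set X),
    (∀ x : X, ∃ i, ∃ U ∈ 𝒰 i, x ∈ U) ∧
    (∀ i, RDisjoint r (𝒰 i)) ∧
    (∀ i, ∀ U ∈ 𝒰 i, Metric.ediam U ≤ (D r : ℝ≥0∞))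

/-- The shortest-path metric on the vertices of a graph; vertices in different connected
components are at infinite distance. -/
@[reducible]
noncomputable def graphMetric {V : Type u} (G : SimpleGraph V) : EMetricSpace V where
  edist x y := (G.edist x y : ℝ≥0∞)
  edist_self x := by simp
  edist_comm x y := by rw [SimpleGraph.edist_comm]
  edist_triangle x y z := by
    rw [← ENat.toENNReal_add, ENat.toENNReal_le]
    exact G.edist_triangle
  eq_of_edist_eq_zero := by
    intro x y h
    exact SimpleGraph.edist_eq_zero_iff.mp (ENat.toENNReal_eq_zero.mp h)

/-- A class of graphs. -/
abbrev GraphClass := ∀ V : Type u, SimpleGraph V → Prop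

/-- The asymptotic dimension of a class of graphs: the least `n` such that a single function is an
`n`-dimensional control function for every member of the class, and `⊤` if there is no such `n`. -/
noncomputable def asdim (𝒢 : GraphClass.{u}) : ℕ∞ :=
  ⨅ (n : ℕ) (_ : ∃ D : ℝ≥0 → ℝ≥0, ∀ (V : Type u) (G : SimpleGraph V), 𝒢 V G →
    @IsControlFunction V (graphMetric G) n D), (n : ℕ∞)

/-- `(T, B)` is a tree-decomposition of `G`. -/
structure IsTreeDecomposition {V : Type u} (G : SimpleGraph V) {ι : Type v} (T : SimpleGraph ι)
    (B : ι → Set V) : Prop where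
  isTree : T.IsTree
  /-- The nodes whose bag contains a given vertex induce a non-empty subtree. -/
  subtree : ∀ x : V, (T.induce {i | x ∈ B i}).IsTree
  edge : ∀ x y : V, G.Adj x y → ∃ i, x ∈ B i ∧ y ∈ B i

/-- A layering, as a function to `ℕ` that varies by at most one along each edge. -/
def IsLayering {V : Type u} (G : SimpleGraph V) (L : V → ℕ) : Prop :=
  ∀ x y : V, G.Adj x y → |(L x : ℤ) - (L y : ℤ)| ≤ 1

/-- `G` has layered pathwidth at most `k`: it has a tree-decomposition whose tree is a (finite) path
and a layering, such that each bag meets each layer in at most `k` vertices. -/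
def LayeredPathwidthLE {V : Type u} (G : SimpleGraph V) (k : ℕ) : Prop :=
  ∃ (m : ℕ) (B : Fin m → Set V) (L : V → ℕ),
    IsTreeDecomposition G (SimpleGraph.pathGraph m) B ∧ IsLayering G L ∧
    ∀ (i : Fin m) (j : ℕ), (B i ∩ {x | L x = j}).encard ≤ (k : ℕ∞)

/-- `H` is a minor of `G`: there are disjoint connected sets of vertices of `G` (which are
contracted to the vertices of `H`), with an edge of `G` between the sets of `a` and `b` for
every edge `ab` of `H` (all other vertices and edges are deleted). -/
def IsMinor {W : Type w} {V : Type u} (H : SimpleGraph W) (G : SimpleGraph V) : Prop :=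
  ∃ B : W → Set V,
    (∀ a, (G.induce (B a)).Connected) ∧
    (∀ a b, a ≠ b → Disjoint (B a) (B b)) ∧
    (∀ a b, H.Adj a b → ∃ x ∈ B a, ∃ y ∈ B b, G.Adj x y)

/-- `H` is an apex-forest: `H - a` is a forest for some vertex `a`. -/
def IsApexForest {W : Type w} (H : SimpleGraph W) : Prop :=
  ∃ a : W, (H.induce {a}ᶜ).IsAcyclic

/-- The class of finite graphs of layered pathwidth at most `k`. -/
def layeredPathwidthClass (k : ℕ) : GraphClass.{u} :=
  fun V G => Finite V ∧ LayeredPathwidthLE G k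

/-- The class of finite graphs that do not contain `H` as a minor. -/
def minorFreeClass {W : Type w} (H : SimpleGraph W) : GraphClass.{u} :=
  fun V G => Finite V ∧ ¬ IsMinor H G

end Asdim

namespace Asdim

/-! A cover of a graph by three sets whose components at scale `r` have diameter bounded in terms of
`r` alone is enough: these components are the members of the three families (`asdim_le_two`).

Passing from the annuli of a layering, that is, blocks of boundedly many consecutive layers, to the
whole graph costs one dimension (`exists_three_cover`). It therefore suffices that annuli have
uniform one-dimensional covers, and for this bounded pathwidth is enough (`exists_two_cover`).
Indeed, in each component a geodesic from the first bag to the last one meets every bag in between,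
so deleting these geodesics lowers the bag size. A neighbourhood of a geodesic looks like an
interval, and `BoundedChains.union` glues its cover to the inductive cover of the rest. Both claims
are thus reduced to finding a layering in which the pathwidth of an annulus is bounded in terms of
its width (`asdim_le_two_of_layering`).

For layered pathwidth at most `k` the given layering works, as `w + 1` layers meet a bag in at most
`k * (w + 1)` vertices. If an apex-forest `H` is excluded, a breadth-first layering works. An
annulus of large pathwidth would contain any prescribed tree as a minor
(`sweepable_or_exists_treeModel`). A suitably large tree yields a model of the forest `H - a` on or
above some layer, with all parts meeting that layer (`exists_tree_forall_model`). The vertices below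
the layer are joined through the breadth-first root and serve as the apex, so `H` would be a minor
(`isMinor_of_treeModel`). -/

variable {V : Type u} (G : SimpleGraph V)

/-! ### Components at scale `r` and how covers combine -/

/-- Points of `S` joined by a sequence of points of `S` with jumps of length at most `r`. -/
def Chain (r : ℕ) (S : Set V) : V → V → Prop :=
  Relation.ReflTransGen (fun a b => a ∈ S ∧ b ∈ S ∧ G.edist a b ≤ (r : ℕ∞))

/-- The `r`-components of `S` have diameter at most `D` in `G`. -/
def BoundedChains (r D : ℕ) (S : Set V) : Prop :=
  ∀ x y, Chain G r S x y → G.edist x y ≤ (D : ℕ∞)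

variable {G}

lemma edist_le_add {x y z : V} {a b : ℕ} (h₁ : G.edist x y ≤ (a : ℕ∞))
    (h₂ : G.edist y z ≤ (b : ℕ∞)) : G.edist x z ≤ ((a + b : ℕ) : ℕ∞) := by
  push_cast
  exact G.edist_triangle.trans (add_le_add h₁ h₂)

lemma edist_le_mono {x y : V} {a b : ℕ} (h₁ : G.edist x y ≤ (a : ℕ∞)) (h : a ≤ b) :
    G.edist x y ≤ (b : ℕ∞) :=
  h₁.trans (by exact_mod_cast h)

lemma Chain.symm {r : ℕ} {S : Set V} {x y : V} (h : Chain G r S x y) : Chain G r S y x := by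
  induction h with
  | refl => exact .refl
  | tail _ hab ih =>
    exact Relation.ReflTransGen.head ⟨hab.2.1, hab.1, by rw [SimpleGraph.edist_comm]; exact hab.2.2⟩ ih

lemma Chain.mono {r r' : ℕ} {S S' : Set V} (hr : r ≤ r') (hS : S ⊆ S') {x y : V}
    (h : Chain G r S x y) : Chain G r' S' x y :=
  Relation.ReflTransGen.mono (fun _ _ hab => ⟨hS hab.1, hS hab.2.1, edist_le_mono hab.2.2 hr⟩) _ _ h

lemma BoundedChains.mono {r r' D D' : ℕ} {S S' : Set V} (h : BoundedChains G r D S)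
    (hr : r' ≤ r) (hD : D ≤ D') (hS : S' ⊆ S) : BoundedChains G r' D' S' :=
  fun x y hxy => edist_le_mono (h x y (hxy.mono hr hS)) hD

lemma Chain.mem_of_mem {r : ℕ} {S : Set V} {x y : V} (h : Chain G r S x y) (hx : x ∈ S) :
    y ∈ S := by
  induction h with
  | refl => exact hx
  | tail _ h _ => exact h.2.1

/-- Sets that can be told apart by a label which is constant at scale `r`. -/
lemma BoundedChains.of_label {α : Type*} {r D : ℕ} {S : Set V} (f : V → α)
    (hf : ∀ x ∈ S, ∀ y ∈ S, G.edist x y ≤ (r : ℕ∞) → f x = f y)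
    (h : ∀ c, BoundedChains G r D (S ∩ {x | f x = c})) : BoundedChains G r D S := by
  intro x y hxy
  have key : f y = f x ∧ Chain G r (S ∩ {z | f z = f x}) x y := by
    induction hxy with
    | refl => exact ⟨rfl, Relation.ReflTransGen.refl⟩
    | tail _ hbc ih =>
      obtain ⟨hb, hc, hbc⟩ := hbc
      have hcb := hf _ hb _ hc hbc
      exact ⟨hcb.symm.trans ih.1, ih.2.tail ⟨⟨hb, ih.1⟩, ⟨hc, hcb.symm.trans ih.1⟩, hbc⟩⟩
  exact h _ _ _ key.2

lemma BoundedChains.of_diam {r D : ℕ} {S : Set V}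
    (h : ∀ x ∈ S, ∀ y ∈ S, G.edist x y ≤ (D : ℕ∞)) : BoundedChains G r D S := by
  intro x y hxy
  by_cases hx : x ∈ S
  · exact h x hx y (hxy.mem_of_mem hx)
  · obtain rfl | ⟨z, hz, -⟩ := Relation.ReflTransGen.cases_head hxy
    · simp
    · exact absurd hz.1 hx

/-- Absorbing a set that is bounded at a small scale into one that is bounded at a larger scale. -/
lemma BoundedChains.union {r D₁ D₂ : ℕ} {A B : Set V} (hA : BoundedChains G r D₁ A)
    (hB : BoundedChains G (D₁ + 2 * r) D₂ B) :
    BoundedChains G r (D₂ + 2 * (D₁ + r)) (A ∪ B) := by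
  intro x y hxy
  by_cases hx : x ∈ A ∪ B
  swap
  · obtain rfl | ⟨z, hz, -⟩ := Relation.ReflTransGen.cases_head hxy
    · simp
    · exact absurd hz.1 hx
  -- Invariant along the chain: `b₀` is the first point of `B` met and `b` the last one so far. An
  -- excursion into `A` between two points of `B` has length at most `r + D₁ + r`, so the visits to
  -- `B` form a chain at scale `D₁ + 2 * r`.
  have key : (y ∈ A ∧ Chain G r A x y) ∨ ∃ b₀ b, b ∈ B ∧ G.edist x b₀ ≤ ((D₁ + r : ℕ) : ℕ∞) ∧
      Chain G (D₁ + 2 * r) B b₀ b ∧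
      (y = b ∨ ∃ a, y ∈ A ∧ G.edist b a ≤ (r : ℕ∞) ∧ Chain G r A a y) := by
    induction hxy with
    | refl =>
      rcases hx with hx | hx
      · exact .inl ⟨hx, .refl⟩
      · exact .inr ⟨x, x, hx, by simp, .refl, .inl rfl⟩
    | @tail y z _ hyz ih =>
      obtain ⟨-, hz, hyz⟩ := hyz
      rcases hz with hz | hz
      · rcases ih with ⟨hy, ih⟩ | ⟨b₀, b, hb, hx₀, hc, rfl | ⟨a, hy, hba, hay⟩⟩
        · exact .inl ⟨hz, ih.tail ⟨hy, hz, hyz⟩⟩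
        · exact .inr ⟨b₀, y, hb, hx₀, hc, .inr ⟨z, hz, hyz, .refl⟩⟩
        · exact .inr ⟨b₀, b, hb, hx₀, hc, .inr ⟨a, hz, hba, hay.tail ⟨hy, hz, hyz⟩⟩⟩
      · rcases ih with ⟨hy, ih⟩ | ⟨b₀, b, hb, hx₀, hc, rfl | ⟨a, hy, hba, hay⟩⟩
        · exact .inr ⟨z, z, hz, edist_le_add (hA _ _ ih) hyz, .refl, .inl rfl⟩
        · exact .inr ⟨b₀, z, hz, hx₀, hc.tail ⟨hb, hz, edist_le_mono hyz (by omega)⟩, .inl rfl⟩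
        · refine .inr ⟨b₀, z, hz, hx₀, hc.tail ⟨hb, hz, ?_⟩, .inl rfl⟩
          exact edist_le_mono (edist_le_add (edist_le_add hba (hA _ _ hay)) hyz) (by omega)
  rcases key with ⟨_, h⟩ | ⟨b₀, b, hb, hx₀, hc, rfl | ⟨a, hy, hba, hay⟩⟩
  · exact edist_le_mono (hA _ _ h) (by omega)
  · exact edist_le_mono (edist_le_add hx₀ (hB _ _ hc)) (by omega)
  · exact edist_le_mono (edist_le_add (edist_le_add hx₀ (hB _ _ hc))
      (edist_le_add hba (hA _ _ hay))) (by omega)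

/-- Replacing each point of a chain by a nearby point of `S` turns jumps of length `r` into jumps of
length `3 * r`. -/
lemma BoundedChains.thickening {r D : ℕ} {S : Set V} (hS : BoundedChains G (3 * r) D S) :
    BoundedChains G r (D + 2 * r) {x | ∃ s ∈ S, G.edist x s ≤ (r : ℕ∞)} := by
  intro x y hxy
  by_cases hx : ∃ s ∈ S, G.edist x s ≤ (r : ℕ∞)
  swap
  · obtain rfl | ⟨z, hz, -⟩ := Relation.ReflTransGen.cases_head hxy
    · simp
    · exact absurd hz.1 hx
  obtain ⟨s, hs, hxs⟩ := hx
  have key : ∃ t ∈ S, G.edist y t ≤ (r : ℕ∞) ∧ Chain G (3 * r) S s t := by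
    induction hxy with
    | refl => exact ⟨s, hs, hxs, .refl⟩
    | tail _ hyz ih =>
      obtain ⟨t, ht, hyt, hst⟩ := ih
      obtain ⟨-, ⟨t', ht', hzt⟩, hyz⟩ := hyz
      refine ⟨t', ht', hzt, hst.tail ⟨ht, ht', ?_⟩⟩
      rw [SimpleGraph.edist_comm] at hyt
      exact edist_le_mono (edist_le_add (edist_le_add hyt hyz) hzt) (by omega)
  obtain ⟨t, -, hyt, hst⟩ := key
  rw [SimpleGraph.edist_comm] at hyt
  exact edist_le_mono (edist_le_add (edist_le_add hxs (hS _ _ hst)) hyt) (by omega)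

/-- Kolmogorov's trick: from a cover by two sets to a double cover by three sets. -/
lemma exists_double_cover {r D : ℕ} {S S₀ S₁ : Set V} (hS : S ⊆ S₀ ∪ S₁)
    (h₀ : BoundedChains G (3 * r) D S₀) (h₁ : BoundedChains G (3 * r) D S₁) :
    ∃ E : ℕ → Set V, (∀ i, BoundedChains G r (D + 2 * r) (E i)) ∧
      ∀ x ∈ S, ∀ j, ∃ i < 3, i ≠ j ∧ x ∈ E i := by
  classical
  set N₀ : Set V := {x | ∃ s ∈ S₀, G.edist x s ≤ (r : ℕ∞)} with hN₀
  set N₁ : Set V := {x | ∃ s ∈ S₁, G.edist x s ≤ (r : ℕ∞)} with hN₁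
  -- Points of one set that are far from the other. The two kinds are more than `r` apart, so no
  -- chain of `T` mixes them.
  set T : Set V := (S₀ \ N₁) ∪ (S₁ \ N₀) with hT
  have hTb : BoundedChains G r (D + 2 * r) T := by
    refine BoundedChains.of_label (fun x => decide (x ∈ S₀ \ N₁)) ?_ ?_
    · have aux : ∀ x ∈ T, ∀ y ∈ T, G.edist x y ≤ (r : ℕ∞) → x ∈ S₀ \ N₁ → y ∈ S₀ \ N₁ := by
        rintro x - y (hy | hy) hxy hx
        · exact hy
        · exact absurd ⟨y, hy.1, hxy⟩ hx.2
      intro x hx y hy hxy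
      exact decide_eq_decide.2 ⟨aux x hx y hy hxy, aux y hy x hx (by rwa [SimpleGraph.edist_comm])⟩
    · rintro (_ | _)
      · refine h₁.mono (by omega) (by omega) ?_
        rintro x ⟨hx | hx, hx'⟩
        · simp [hx.1, hx.2] at hx'
        · exact hx.1
      · refine h₀.mono (by omega) (by omega) ?_
        rintro x ⟨-, hx'⟩
        simp only [Set.mem_ofPred_eq, decide_eq_true_eq] at hx'
        exact hx'.1
  refine ⟨fun i => if i = 0 then N₀ else if i = 1 then N₁ else T, fun i => ?_, fun x hx j => ?_⟩
  · dsimp only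
    split_ifs
    · exact h₀.thickening
    · exact h₁.thickening
    · exact hTb
  · have m₀ : x ∈ S₀ → x ∈ N₀ := fun h => ⟨x, h, by simp⟩
    have m₁ : x ∈ S₁ → x ∈ N₁ := fun h => ⟨x, h, by simp⟩
    -- Every point lies in two of the three sets, hence in one whose index differs from any given
    -- `j`.
    have two : (x ∈ N₀ ∧ x ∈ N₁) ∨ (x ∈ N₀ ∧ x ∈ T) ∨ (x ∈ N₁ ∧ x ∈ T) := by
      rcases hS hx with h | h
      · by_cases h' : x ∈ N₁
        · exact .inl ⟨m₀ h, h'⟩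
        · exact .inr (.inl ⟨m₀ h, .inl ⟨h, h'⟩⟩)
      · by_cases h' : x ∈ N₀
        · exact .inl ⟨h', m₁ h⟩
        · exact .inr (.inr ⟨m₁ h, .inr ⟨h, h'⟩⟩)
    by_cases h0 : j = 0
    · subst h0
      rcases two with h | h | h
      · exact ⟨1, by simp, by simp, by simpa using h.2⟩
      · exact ⟨2, by simp, by simp, by simpa using h.2⟩
      · exact ⟨2, by simp, by simp, by simpa using h.2⟩
    by_cases h1 : j = 1
    · subst h1
      rcases two with h | h | h
      · exact ⟨0, by simp, by simp, by simpa using h.1⟩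
      · exact ⟨2, by simp, by simp, by simpa using h.2⟩
      · exact ⟨2, by simp, by simp, by simpa using h.2⟩
    · rcases two with h | h | h
      · exact ⟨0, by simp, by omega, by simpa using h.1⟩
      · exact ⟨0, by simp, by omega, by simpa using h.1⟩
      · exact ⟨1, by simp, by omega, by simpa using h.1⟩

/-! ### From annuli to the whole graph, and to control functions -/

/-- A layering is 1-Lipschitz. -/
lemma IsLayering.le_add {L : V → ℕ} (hL : IsLayering G L) {x y : V} {r : ℕ}
    (h : G.edist x y ≤ (r : ℕ∞)) : L y ≤ L x + r := by
  obtain ⟨p, hp⟩ := (G.reachable_of_edist_ne_top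
    (ne_top_of_le_ne_top (ENat.natCast_ne_top r) h)).exists_walk_length_eq_edist
  have aux : ∀ {x y : V} (p : G.Walk x y), L y ≤ L x + p.length := by
    intro x y p
    induction p with
    | nil => simp
    | cons h p ih =>
      have := abs_le.1 (hL _ _ h)
      simp only [SimpleGraph.Walk.length_cons]
      omega
  have := aux p
  rw [← hp] at h
  have : p.length ≤ r := by exact_mod_cast h
  omega

/-- If all annuli of a layering have one-dimensional covers then the graph has two-dimensional
covers. -/
lemma exists_three_cover {L : V → ℕ} (hL : IsLayering G L) {D : ℕ → ℕ → ℕ}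
    (h : ∀ r w a, ∃ S₀ S₁ : Set V, {x | a ≤ L x ∧ L x ≤ a + w} ⊆ S₀ ∪ S₁ ∧
      BoundedChains G r (D r w) S₀ ∧ BoundedChains G r (D r w) S₁) (r : ℕ) :
    let D₁ := D (3 * r) (3 * (r + 1)) + 2 * r
    let D₂ := D (D₁ + 2 * r) (3 * (r + 1))
    ∃ S : ℕ → Set V, (∀ x, ∃ i < 3, x ∈ S i) ∧
      ∀ i, BoundedChains G r (D₂ + 2 * (D₁ + r)) (S i) := by
  intro D₁ D₂
  -- Slabs of `r + 1` layers: a jump of length at most `r` changes the slab index by at most one.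
  set q : V → ℕ := fun x => L x / (r + 1) with hq
  have hqr : ∀ x y, G.edist x y ≤ (r : ℕ∞) → q y ≤ q x + 1 := by
    intro x y hxy
    have := hL.le_add hxy
    calc L y / (r + 1) ≤ (L x + (r + 1)) / (r + 1) := Nat.div_le_div_right (by omega)
      _ = q x + 1 := by rw [Nat.add_div_right _ (by omega)]
  have hann : ∀ x m l, m ≤ q x → q x < m + l → m * (r + 1) ≤ L x ∧ L x ≤ m * (r + 1) + l * (r + 1) := by
    intro x m l h₁ h₂
    have h₁' := (Nat.le_div_iff_mul_le (by omega)).1 h₁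
    have h₂' := (Nat.div_lt_iff_lt_mul (by omega)).1 h₂
    rw [add_mul] at h₂'
    exact ⟨h₁', h₂'.le⟩
  have hE : ∀ j, ∃ E : ℕ → Set V, (∀ i, BoundedChains G r D₁ (E i)) ∧
      ∀ x, q x / 4 = j → q x % 4 ≠ 3 → ∀ k, ∃ i < 3, i ≠ k ∧ x ∈ E i := by
    intro j
    obtain ⟨S₀, S₁, hS, h₀, h₁⟩ := h (3 * r) (3 * (r + 1)) (4 * j * (r + 1))
    obtain ⟨E, hE, hcov⟩ := exists_double_cover hS h₀ h₁
    exact ⟨E, hE, fun x hx hx' => hcov x (hann x (4 * j) 3 (by omega) (by omega))⟩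
  -- The slabs with index `3` mod `4` separate the blocks of three slabs treated in `hE`. They are
  -- covered at the larger scale that `BoundedChains.union` demands.
  have hF : ∀ j, ∃ F : ℕ → Set V, (∀ i, BoundedChains G (D₁ + 2 * r) D₂ (F i)) ∧
      ∀ x, q x = 4 * j + 3 → ∃ i < 3, x ∈ F i := by
    intro j
    obtain ⟨S₀, S₁, hS, h₀, h₁⟩ := h (D₁ + 2 * r) (3 * (r + 1)) ((4 * j + 3) * (r + 1))
    refine ⟨fun i => if i = 0 then S₀ else S₁, fun i => ?_, fun x hx => ?_⟩
    · dsimp only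
      split_ifs
      · exact h₀
      · exact h₁
    · rcases hS (hann x (4 * j + 3) 3 (by omega) (by omega)) with hx | hx
      · exact ⟨0, by simp, by simpa using hx⟩
      · exact ⟨1, by simp, by simpa using hx⟩
  choose E hE hEcov using hE
  choose F hF hFcov using hF
  -- Colour `i` is forbidden on the slabs with index `i` mod `4`. The double cover makes this
  -- affordable: every point of a block still has an admissible colour.
  set A : ℕ → Set V := fun i => {x | q x % 4 ≠ 3 ∧ q x % 4 ≠ i ∧ x ∈ E (q x / 4) i} with hA
  set B : ℕ → Set V := fun i => {x | q x % 4 = 3 ∧ x ∈ F (q x / 4) i} with hB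
  refine ⟨fun i => if i < 3 then A i ∪ B i else ∅, fun x => ?_, fun i => ?_⟩
  · by_cases hx : q x % 4 = 3
    · obtain ⟨i, hi, hxi⟩ := hFcov (q x / 4) x (by omega)
      exact ⟨i, hi, by simpa [hi] using Or.inr ⟨hx, hxi⟩⟩
    · obtain ⟨i, hi, hne, hxi⟩ := hEcov _ x rfl hx (q x % 4)
      exact ⟨i, hi, by simpa [hi] using Or.inl ⟨hx, hne.symm, hxi⟩⟩
  dsimp only
  split_ifs with hi
  swap
  · exact BoundedChains.of_diam (by simp)
  have hAb : BoundedChains G r D₁ (A i) := by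
    refine BoundedChains.of_label (fun x => q x / 4) ?_ fun c => ?_
    · intro x hx y hy hxy
      have h₁ := hqr x y hxy
      have h₂ := hqr y x (by rwa [SimpleGraph.edist_comm])
      have h₃ := hx.1
      have h₄ := hy.1
      omega
    · refine (hE c i).mono le_rfl le_rfl ?_
      rintro x ⟨hx, rfl⟩
      exact hx.2.2
  -- Colour `i` misses every slab with index `i` mod `4`, so it splits into runs of three slabs,
  -- which this label numbers. As `i < 3`, each run contains exactly one separating slab, so a
  -- single `F j` controls the part in `B i`.
  refine BoundedChains.of_label (fun x => (q x + 3 - i) / 4) ?_ fun c => ?_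
  · have hne : ∀ x ∈ A i ∪ B i, q x % 4 ≠ i := by
      rintro x (hx | hx)
      · exact hx.2.1
      · have := hx.1
        omega
    intro x hx y hy hxy
    have h₁ := hqr x y hxy
    have h₂ := hqr y x (by rwa [SimpleGraph.edist_comm])
    have h₃ := hne x hx
    have h₄ := hne y hy
    omega
  · refine BoundedChains.mono (BoundedChains.union hAb (B := B i ∩ {x | (q x + 3 - i) / 4 = c}) ?_)
      le_rfl le_rfl ?_
    · by_cases hc : ∃ x₀, x₀ ∈ B i ∩ {x | (q x + 3 - i) / 4 = c}
      · obtain ⟨x₀, hx₀, hc⟩ := hc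
        refine (hF (q x₀ / 4) i).mono le_rfl le_rfl ?_
        rintro x ⟨hx, hxc⟩
        have h₁ := hx.1
        have h₂ := hx₀.1
        simp only [Set.mem_ofPred_eq] at hxc hc
        have : q x / 4 = q x₀ / 4 := by omega
        rw [← this]
        exact hx.2
      · exact BoundedChains.of_diam fun x hx => absurd ⟨x, hx⟩ hc
    · rintro x ⟨hx | hx, hxc⟩
      · exact .inl hx
      · exact .inr ⟨hx, hxc⟩

/-- Graphs with covers by three sets with bounded components have a common control function. -/
lemma asdim_le_two {𝒢 : GraphClass.{u}}
    (h : ∀ r : ℕ, ∃ D : ℕ, ∀ (V : Type u) (G : SimpleGraph V), 𝒢 V G →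
      ∃ S : ℕ → Set V, (∀ x, ∃ i < 3, x ∈ S i) ∧ ∀ i, BoundedChains G r D (S i)) :
    asdim 𝒢 ≤ 2 := by
  choose D hD using h
  refine iInf₂_le_of_le 2 ⟨fun r => (D ⌈r⌉₊ : ℝ≥0), fun V G hG r _ => ?_⟩ le_rfl
  obtain ⟨S, hcov, hS⟩ := hD ⌈r⌉₊ V G hG
  -- The families consist of the components of `S i` at scale `⌈r⌉₊`; two of them at distance at
  -- most `r` coincide.
  refine ⟨fun i => {U | ∃ x ∈ S i, U = {y | Chain G ⌈r⌉₊ (S i) x y}}, fun x => ?_, ?_, ?_⟩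
  · obtain ⟨i, hi, hx⟩ := hcov x
    exact ⟨⟨i, hi⟩, _, ⟨x, hx, rfl⟩, .refl⟩
  · rintro i _ ⟨x, hx, rfl⟩ _ ⟨y, hy, rfl⟩ hne a ha b hb
    by_contra hab
    rw [not_lt] at hab
    apply hne
    have hab' : G.edist a b ≤ ((⌈r⌉₊ : ℕ) : ℕ∞) := by
      rw [← ENat.toENNReal_le]
      refine le_trans hab ?_
      rw [ENat.toENNReal_coe]
      exact_mod_cast Nat.le_ceil r
    have hxy : Chain G ⌈r⌉₊ (S i) x y :=
      (Relation.ReflTransGen.tail ha ⟨ha.mem_of_mem hx, hb.mem_of_mem hy, hab'⟩).trans hb.symm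
    ext z
    exact ⟨fun hz => hxy.symm.trans hz, fun hz => hxy.trans hz⟩
  · rintro i _ ⟨x, hx, rfl⟩
    let := graphMetric G
    refine Metric.ediam_le fun a ha b hb => ?_
    have := hS i a b (ha.symm.trans hb)
    rw [← ENat.toENNReal_le] at this
    exact this.trans (by simp)

/-! ### Bounded pathwidth gives one-dimensional covers -/

/-- A path-decomposition indexed by `ℕ`, with finitely many non-empty bags, of size at most `p`. -/
structure PathBags (G : SimpleGraph V) (p : ℕ) (B : ℕ → Set V) : Prop where
  convex : ∀ {i j k : ℕ} {x : V}, i ≤ j → j ≤ k → x ∈ B i → x ∈ B k → x ∈ B j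
  edge : ∀ {x y : V}, G.Adj x y → ∃ i, x ∈ B i ∧ y ∈ B i
  cover : ∀ x, ∃ i, x ∈ B i
  bounded : ∃ N, ∀ i x, x ∈ B i → i ≤ N
  card : ∀ i, (B i).encard ≤ (p : ℕ∞)

/-- Bags separate: consecutive vertices of a walk share a bag, so by convexity the walk cannot jump
over bag `t`. -/
lemma PathBags.exists_mem_support {p : ℕ} {B : ℕ → Set V} (hB : PathBags G p B) {t : ℕ} {x y : V}
    (w : G.Walk x y) {i j : ℕ} (hi : i ≤ t) (hj : t ≤ j) (hx : x ∈ B i) (hy : y ∈ B j) :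
    ∃ z ∈ w.support, z ∈ B t := by
  induction w generalizing i with
  | nil => exact ⟨_, by simp, hB.convex hi hj hx hy⟩
  | cons h w ih =>
    obtain ⟨k, hk, hk'⟩ := hB.edge h
    rcases le_total k t with hkt | hkt
    · obtain ⟨z, hz, hz'⟩ := ih hkt hk' hy
      exact ⟨z, by simp [hz], hz'⟩
    · exact ⟨_, by simp, hB.convex hi hkt hx hk⟩

lemma edist_getVert_le {x y : V} (w : G.Walk x y) {i j : ℕ} (hij : i ≤ j) :
    G.edist (w.getVert i) (w.getVert j) ≤ ((j - i : ℕ) : ℕ∞) := by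
  have h := ((w.drop i).take (j - i)).edist_le
  rw [SimpleGraph.Walk.take_length, SimpleGraph.Walk.drop_getVert, Nat.add_sub_of_le hij] at h
  exact h.trans (by exact_mod_cast min_le_left _ _)

/-- In every component there is a geodesic that meets all bags that meet the component. -/
lemma PathBags.exists_geodesic {p : ℕ} {B : ℕ → Set V} (hB : PathBags G p B)
    (c : G.ConnectedComponent) : ∃ (u : V) (P : Set V), u ∈ c.supp ∧ P ⊆ c.supp ∧
      (∀ q ∈ P, ∀ q' ∈ P, G.dist u q ≤ G.dist u q' →
        G.edist q q' ≤ ((G.dist u q' - G.dist u q : ℕ) : ℕ∞)) ∧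
      ∀ i, ∀ x ∈ c.supp, x ∈ B i → ∃ y ∈ P, y ∈ B i := by
  classical
  obtain ⟨N, hN⟩ := hB.bounded
  have hex : ∃ i, ∃ x ∈ c.supp, x ∈ B i := by
    obtain ⟨x, hx⟩ := c.nonempty_supp
    obtain ⟨i, hi⟩ := hB.cover x
    exact ⟨i, x, hx, hi⟩
  -- `u` lies in the first bag that meets the component and `v` below in the last one, so every walk
  -- between them meets all the bags that matter.
  obtain ⟨u, huc, hu⟩ := Nat.find_spec hex
  obtain ⟨i₀, hi₀⟩ := hex
  have hmax := Nat.findGreatest_spec (P := fun i => ∃ x ∈ c.supp, x ∈ B i) (n := N)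
    (hi₀.elim fun x hx => hN i₀ x hx.2) hi₀
  obtain ⟨v, hvc, hv⟩ := hmax
  have huv : G.Reachable u v := SimpleGraph.ConnectedComponent.exact (huc.trans hvc.symm)
  obtain ⟨w, hw⟩ := huv.exists_walk_length_eq_dist
  have hdist : ∀ i, i ≤ w.length → G.dist u (w.getVert i) = i := by
    intro i hi
    have h₁ := SimpleGraph.dist_le (w.take i)
    have h₂ := SimpleGraph.dist_le (w.drop i)
    have h₃ := SimpleGraph.Reachable.dist_triangle_left ⟨w.take i⟩ v
    rw [SimpleGraph.Walk.take_length] at h₁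
    rw [SimpleGraph.Walk.drop_length] at h₂
    omega
  refine ⟨u, {x | x ∈ w.support}, huc, ?_, ?_, ?_⟩
  · intro x hx
    obtain ⟨n, rfl, -⟩ := SimpleGraph.Walk.mem_support_iff_exists_getVert.1 hx
    exact (SimpleGraph.ConnectedComponent.sound ⟨(w.take n).reverse⟩).trans huc
  · intro q hq q' hq' hle
    obtain ⟨m, rfl, hm⟩ := SimpleGraph.Walk.mem_support_iff_exists_getVert.1 hq
    obtain ⟨n, rfl, hn⟩ := SimpleGraph.Walk.mem_support_iff_exists_getVert.1 hq'
    rw [hdist m hm, hdist n hn] at *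
    exact edist_getVert_le w hle
  · intro i x hx hxi
    exact hB.exists_mem_support w (Nat.find_min' _ ⟨x, hx, hxi⟩)
      (Nat.le_findGreatest (hN i x hxi) ⟨x, hx, hxi⟩) hu hv

lemma edist_le_edist_induce {s : Set V} (x y : s) :
    G.edist x y ≤ (G.induce s).edist x y := by
  by_cases h : (G.induce s).Reachable x y
  · obtain ⟨w, hw⟩ := h.exists_walk_length_eq_edist
    rw [← hw]
    rw [← SimpleGraph.Walk.length_map (SimpleGraph.Embedding.induce s).toHom w]
    exact SimpleGraph.Walk.edist_le _
  · simp [SimpleGraph.edist_eq_top_of_not_reachable h]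

/-- A shortest walk from `x` to `y` stays in the ball of radius `r` around `x`, hence in `s`. -/
lemma edist_induce_le {s : Set V} {r : ℕ} (x y : s)
    (hs : ∀ z, G.edist x z ≤ (r : ℕ∞) → z ∈ s) (h : G.edist x y ≤ (r : ℕ∞)) :
    (G.induce s).edist x y ≤ (r : ℕ∞) := by
  obtain ⟨w, hw⟩ := (G.reachable_of_edist_ne_top
    (ne_top_of_le_ne_top (ENat.natCast_ne_top r) h)).exists_walk_length_eq_edist
  have hsupp : ∀ z ∈ w.support, z ∈ s := by
    intro z hz
    obtain ⟨n, rfl, hn⟩ := SimpleGraph.Walk.mem_support_iff_exists_getVert.1 hz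
    refine hs _ (le_trans ?_ h)
    rw [← hw]
    refine (w.take n).edist_le.trans ?_
    rw [SimpleGraph.Walk.take_length]
    exact_mod_cast min_le_right _ _
  refine le_trans (w.induce s hsupp).edist_le ?_
  have hl := congrArg SimpleGraph.Walk.length (w.map_induce hsupp)
  rw [SimpleGraph.Walk.length_map] at hl
  rw [hl]
  exact hw.le.trans h

/-- At points whose `r`-ball lies in `s`, jumps of length at most `r` in `G` are also jumps in the
induced graph, so chains transfer. -/
lemma BoundedChains.of_induce {s : Set V} {r D : ℕ} {S : Set s}
    (h : BoundedChains (G.induce s) r D S) :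
    BoundedChains G r D {x | (∀ z, G.edist x z ≤ (r : ℕ∞) → z ∈ s) ∧ ∃ hx : x ∈ s, ⟨x, hx⟩ ∈ S} := by
  set T : Set V := {x | (∀ z, G.edist x z ≤ (r : ℕ∞) → z ∈ s) ∧ ∃ hx : x ∈ s, ⟨x, hx⟩ ∈ S} with hT
  intro x y hxy
  by_cases hxT : x ∈ T
  swap
  · obtain rfl | ⟨z, hz, -⟩ := Relation.ReflTransGen.cases_head hxy
    · simp
    · exact absurd hz.1 hxT
  have key : ∃ hy : y ∈ s, Chain (G.induce s) r S ⟨x, hxT.2.1⟩ ⟨y, hy⟩ := by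
    induction hxy with
    | refl => exact ⟨_, .refl⟩
    | @tail y z _ hyz ih =>
      obtain ⟨hy, ih⟩ := ih
      obtain ⟨hyT, hzT, hyz⟩ := hyz
      exact ⟨hzT.2.1, ih.tail ⟨hyT.2.2, hzT.2.2, edist_induce_le ⟨y, hy⟩ ⟨z, hzT.2.1⟩ hyT.1 hyz⟩⟩
  obtain ⟨hy, hc⟩ := key
  exact (edist_le_edist_induce _ _).trans (h _ _ hc)

/-- Neighbourhoods of a union of geodesics, one in each component, are one-dimensional. -/
lemma exists_cover_thickening {u : G.ConnectedComponent → V} {P : G.ConnectedComponent → Set V}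
    (hu : ∀ c, u c ∈ c.supp) (hP : ∀ c, P c ⊆ c.supp)
    (hgeo : ∀ c, ∀ q ∈ P c, ∀ q' ∈ P c, G.dist (u c) q ≤ G.dist (u c) q' →
      G.edist q q' ≤ ((G.dist (u c) q' - G.dist (u c) q : ℕ) : ℕ∞)) (r R : ℕ) :
    ∃ S₀ S₁ : Set V, {x | ∃ c, ∃ q ∈ P c, G.edist x q ≤ (r : ℕ∞)} ⊆ S₀ ∪ S₁ ∧
      BoundedChains G R (R + 4 * r + 1) S₀ ∧ BoundedChains G R (R + 4 * r + 1) S₁ := by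
  classical
  -- Points at distance at most `R` project to points of the geodesic at distance at most `R + 2 *
  -- r`. Cutting the geodesic into blocks of length `M`, they fall in equal or adjacent blocks, and
  -- the parity of the block gives the two sets.
  set M := R + 2 * r + 1 with hM
  set T : Set V := {x | ∃ c, ∃ q ∈ P c, G.edist x q ≤ (r : ℕ∞)} with hT
  have hex : ∀ x : V, ∃ q : V, x ∈ T → q ∈ P (G.connectedComponentMk x) ∧
      G.edist x q ≤ (r : ℕ∞) := by
    intro x
    by_cases hx : x ∈ T
    · obtain ⟨c, q, hq, hxq⟩ := hx
      have hr : G.Reachable x q :=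
        G.reachable_of_edist_ne_top (ne_top_of_le_ne_top (ENat.natCast_ne_top r) hxq)
      refine ⟨q, fun _ => ⟨?_, hxq⟩⟩
      rw [SimpleGraph.ConnectedComponent.sound hr, show G.connectedComponentMk q = c from hP c hq]
      exact hq
    · exact ⟨x, fun h => absurd h hx⟩
  choose q hq using hex
  set c : V → G.ConnectedComponent := G.connectedComponentMk with hc
  set pos : V → ℕ := fun x => G.dist (u (c x)) (q x) with hpos
  have hcr : ∀ x y, G.edist x y ≤ (R : ℕ∞) → c x = c y := fun x y h =>
    SimpleGraph.ConnectedComponent.sound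
      (G.reachable_of_edist_ne_top (ne_top_of_le_ne_top (ENat.natCast_ne_top R) h))
  have hposr : ∀ x ∈ T, ∀ y ∈ T, G.edist x y ≤ (R : ℕ∞) → pos y < pos x + M := by
    intro x hx y hy hxy
    have hcxy := hcr x y hxy
    have hqq : G.edist (q x) (q y) ≤ ((r + R + r : ℕ) : ℕ∞) := by
      refine edist_le_add (edist_le_add ?_ hxy) (hq y hy).2
      rw [SimpleGraph.edist_comm]
      exact (hq x hx).2
    have hux : G.Reachable (u (c x)) (q x) :=
      SimpleGraph.ConnectedComponent.exact ((hu _).trans (hP _ (hq x hx).1).symm)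
    have h₁ := hux.dist_triangle_left (q y)
    have hr : G.Reachable (q x) (q y) :=
      G.reachable_of_edist_ne_top (ne_top_of_le_ne_top (ENat.natCast_ne_top _) hqq)
    rw [← hr.coe_dist_eq_edist] at hqq
    have h₂ : G.dist (q x) (q y) ≤ r + R + r := by exact_mod_cast hqq
    have h₃ : pos y = G.dist (u (c x)) (q y) := by rw [hpos, hcxy]
    have h₄ : pos x = G.dist (u (c x)) (q x) := rfl
    omega
  have hbdd : ∀ e, BoundedChains G R (R + 4 * r + 1) (T ∩ {x | pos x / M % 2 = e}) := by
    intro e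
    have hM0 : 0 < M := by omega
    refine BoundedChains.of_label (fun x => (c x, pos x / M)) ?_ ?_
    · rintro x ⟨hx, hxe⟩ y ⟨hy, hye⟩ hxy
      have aux : ∀ x y, pos y < pos x + M → pos y / M ≤ pos x / M + 1 := by
        intro x y h
        rw [← Nat.add_div_right _ hM0]
        exact Nat.div_le_div_right h.le
      have h₁ := aux _ _ (hposr x hx y hy hxy)
      have h₂ := aux _ _ (hposr y hy x hx (by rwa [SimpleGraph.edist_comm]))
      simp only [Set.mem_ofPred_eq] at hxe hye
      exact Prod.ext (hcr x y hxy) (by dsimp only; omega)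
    · rintro ⟨c₀, m⟩
      have main : ∀ x ∈ T, ∀ y ∈ T, c x = c y → pos x / M = pos y / M → pos x ≤ pos y →
          G.edist x y ≤ ((R + 4 * r + 1 : ℕ) : ℕ∞) := by
        intro x hx y hy hcxy hm hle
        have hqy := (hq y hy).1
        change q y ∈ P (c y) at hqy
        rw [← hcxy] at hqy
        have h₃ : pos y = G.dist (u (c x)) (q y) := by rw [hpos, hcxy]
        have h₁ := hgeo (c x) (q x) (hq x hx).1 (q y) hqy (by rw [← h₃]; exact hle)
        rw [← h₃] at h₁
        have h₅ : pos y < pos x + M := by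
          have e₁ := Nat.div_add_mod (pos x) M
          have e₂ := Nat.div_add_mod (pos y) M
          have e₃ := Nat.mod_lt (pos y) hM0
          rw [hm] at e₁
          omega
        have h₆ := (hq y hy).2
        rw [SimpleGraph.edist_comm] at h₆
        refine edist_le_mono (edist_le_add (edist_le_add (hq x hx).2 h₁) h₆) ?_
        change r + (pos y - pos x) + r ≤ _
        omega
      refine BoundedChains.of_diam ?_
      rintro x ⟨⟨hx, -⟩, hx'⟩ y ⟨⟨hy, -⟩, hy'⟩
      have hxy := Prod.ext_iff.1 (hx'.trans hy'.symm)
      rcases le_total (pos x) (pos y) with h | h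
      · exact main x hx y hy hxy.1 hxy.2 h
      · rw [SimpleGraph.edist_comm]
        exact main y hy x hx hxy.1.symm hxy.2.symm h
  refine ⟨_, _, fun x hx => ?_, hbdd 0, hbdd 1⟩
  rcases Nat.mod_two_eq_zero_or_one (pos x / M) with h | h
  · exact .inl ⟨hx, h⟩
  · exact .inr ⟨hx, h⟩

/-- Graphs of bounded pathwidth have asymptotic dimension at most one, uniformly. -/
theorem exists_two_cover (r p : ℕ) : ∃ D : ℕ, ∀ (V : Type u) (G : SimpleGraph V) (B : ℕ → Set V),
    PathBags G p B → ∃ S₀ S₁ : Set V, Set.univ ⊆ S₀ ∪ S₁ ∧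
      BoundedChains G r D S₀ ∧ BoundedChains G r D S₁ := by
  induction p with
  | zero =>
    refine ⟨0, fun V G B hB => ⟨∅, ∅, fun x _ => ?_, .of_diam (by simp), .of_diam (by simp)⟩⟩
    obtain ⟨i, hi⟩ := hB.cover x
    have := hB.card i
    simp only [Nat.cast_zero, nonpos_iff_eq_zero, Set.encard_eq_zero] at this
    simp [this] at hi
  | succ p ih =>
    obtain ⟨D, hD⟩ := ih
    -- The bound of `BoundedChains.union`, with `D` for the part away from the geodesics and
    -- `exists_cover_thickening` at scale `D + 2 * r` for the part near them.
    refine ⟨(D + 2 * r) + 4 * r + 1 + 2 * (D + r), fun V G B hB => ?_⟩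
    choose u P hu hP hgeo hmeet using hB.exists_geodesic
    set Q : Set V := ⋃ c, P c with hQ
    have hB' : PathBags (G.induce Qᶜ) p (fun i => Subtype.val ⁻¹' B i) := by
      refine ⟨fun h₁ h₂ h₃ h₄ => hB.convex h₁ h₂ h₃ h₄, fun h => hB.edge h, fun x => hB.cover x,
        ?_, fun i => ?_⟩
      · obtain ⟨N, hN⟩ := hB.bounded
        exact ⟨N, fun i x hx => hN i x hx⟩
      -- A non-empty bag meets some component, hence the geodesic of that component, and loses a
      -- vertex.
      · rcases (B i).eq_empty_or_nonempty with h | ⟨x, hx⟩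
        · simp [h]
        obtain ⟨y, hyP, hy⟩ := hmeet (G.connectedComponentMk x) i x rfl hx
        have h₁ := Set.encard_sdiff_singleton_add_one hy
        have h₂ := hB.card i
        rw [← h₁] at h₂
        push_cast at h₂
        have h₃ : (B i \ {y}).encard ≤ (p : ℕ∞) :=
          (ENat.add_le_add_iff_right ENat.one_ne_top).1 h₂
        refine le_trans ?_ h₃
        rw [← Subtype.val_injective.encard_image]
        refine Set.encard_le_encard ?_
        rintro _ ⟨z, hz, rfl⟩
        refine ⟨hz, ?_⟩
        rintro (h : (z : V) = y)
        exact z.2 (h ▸ Set.mem_iUnion.2 ⟨_, hyP⟩)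
    obtain ⟨S₀, S₁, hS, h₀, h₁⟩ := hD _ _ _ hB'
    obtain ⟨T₀, T₁, hT, k₀, k₁⟩ := exists_cover_thickening hu hP hgeo r (D + 2 * r)
    refine ⟨_, _, fun x _ => ?_, h₀.of_induce.union k₀, h₁.of_induce.union k₁⟩
    by_cases hx : ∃ c, ∃ q ∈ P c, G.edist x q ≤ (r : ℕ∞)
    · rcases hT hx with h | h
      · exact .inl (.inr h)
      · exact .inr (.inr h)
    · have hball : ∀ z, G.edist x z ≤ (r : ℕ∞) → z ∈ Qᶜ := by
        intro z hz hzQ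
        obtain ⟨c, hc⟩ := Set.mem_iUnion.1 hzQ
        exact hx ⟨c, z, hc, hz⟩
      have hxQ : x ∈ Qᶜ := hball x (by simp)
      rcases hS (Set.mem_univ ⟨x, hxQ⟩) with h | h
      · exact .inl (.inl ⟨hball, hxQ, h⟩)
      · exact .inr (.inl ⟨hball, hxQ, h⟩)

/-- Layered graphs all of whose annuli have bounded pathwidth have two-dimensional covers. -/
theorem asdim_le_two_of_layering {𝒢 : GraphClass.{u}} (p : ℕ → ℕ)
    (h : ∀ (V : Type u) (G : SimpleGraph V), 𝒢 V G → ∃ L : V → ℕ, IsLayering G L ∧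
      ∀ w a, ∃ B, PathBags (G.induce {x | a ≤ L x ∧ L x ≤ a + w}) (p w) B) :
    asdim 𝒢 ≤ 2 := by
  choose D hD using exists_two_cover.{u}
  set E : ℕ → ℕ → ℕ := fun r w => D r (p (w + 2 * r)) with hE
  refine asdim_le_two fun r => ⟨E (E (3 * r) (3 * (r + 1)) + 2 * r + 2 * r) (3 * (r + 1)) +
    2 * (E (3 * r) (3 * (r + 1)) + 2 * r + r), fun V G hG => ?_⟩
  obtain ⟨L, hL, hp⟩ := h V G hG
  refine exists_three_cover hL (D := E) (fun r w a => ?_) r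
  -- The annulus is widened by `r` on both sides so that `r`-balls around its points fit; truncation
  -- of `a - r` at `0` does no harm.
  obtain ⟨B, hB⟩ := hp (w + 2 * r) (a - r)
  obtain ⟨S₀, S₁, hS, h₀, h₁⟩ := hD _ _ _ _ _ hB
  refine ⟨_, _, ?_, h₀.of_induce, h₁.of_induce⟩
  rintro x ⟨hx₁, hx₂⟩
  have hball : ∀ z, G.edist x z ≤ (r : ℕ∞) →
      z ∈ {x | a - r ≤ L x ∧ L x ≤ a - r + (w + 2 * r)} := by
    intro z hz
    have h₁ := hL.le_add hz
    have h₂ := hL.le_add (x := z) (y := x) (r := r) (by rwa [SimpleGraph.edist_comm])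
    constructor <;> omega
  have hxm := hball x (by simp)
  rcases hS (Set.mem_univ ⟨x, hxm⟩) with h | h
  · exact .inl ⟨hball, hxm, h⟩
  · exact .inr ⟨hball, hxm, h⟩

/-! ### Boundaries of vertex sets and Menger's theorem -/

/-- The inner vertex boundary of a set of vertices. -/
def innerBoundary (G : SimpleGraph V) (X : Set V) : Set V :=
  {x | x ∈ X ∧ ∃ y, y ∉ X ∧ G.Adj x y}

lemma innerBoundary_insert_subset (x : V) (X : Set V) :
    innerBoundary G (insert x X) ⊆ insert x (innerBoundary G X) := by
  rintro y ⟨rfl | hy, z, hz, hyz⟩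
  · exact .inl rfl
  · exact .inr ⟨hy, z, fun h => hz (.inr h), hyz⟩

lemma innerBoundary_mono_graph {G' : SimpleGraph V} (h : G' ≤ G) (X : Set V) :
    innerBoundary G' X ⊆ innerBoundary G X :=
  fun _ ⟨hx, y, hy, hxy⟩ => ⟨hx, y, hy, h hxy⟩

/-- A vertex counted on the left lies in one of the boundaries on the right, and a vertex counted
twice lies in both. -/
lemma ncard_innerBoundary_submodular [Finite V] (A B : Set V) :
    (innerBoundary G (A ∩ B)).ncard + (innerBoundary G (A ∪ B)).ncard ≤
      (innerBoundary G A).ncard + (innerBoundary G B).ncard := by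
  rw [← Set.ncard_union_add_ncard_inter (innerBoundary G (A ∩ B)),
    ← Set.ncard_union_add_ncard_inter (innerBoundary G A)]
  refine add_le_add (Set.ncard_le_ncard ?_) (Set.ncard_le_ncard ?_)
  · rintro x (⟨⟨hA, hB⟩, y, hy, hxy⟩ | ⟨hA | hB, y, hy, hxy⟩)
    · by_cases h : y ∈ A
      · exact .inr ⟨hB, y, fun h' => hy ⟨h, h'⟩, hxy⟩
      · exact .inl ⟨hA, y, h, hxy⟩
    · exact .inl ⟨hA, y, fun h => hy (.inl h), hxy⟩
    · exact .inr ⟨hB, y, fun h => hy (.inr h), hxy⟩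
  · rintro x ⟨⟨⟨hA, hB⟩, -⟩, ⟨-, y, hy, hxy⟩⟩
    exact ⟨⟨hA, y, fun h => hy (.inl h), hxy⟩, ⟨hB, y, fun h => hy (.inr h), hxy⟩⟩

lemma connected_induce_singleton (x : V) : (G.induce {x}).Connected :=
  .of_subsingleton

/-- The boundaries of `A ⊆ B` are linked by disjoint connected sets, one for each point of the
boundary of `A`, that meet `A` only in this point. -/
def Linked (G : SimpleGraph V) (A B : Set V) : Prop :=
  ∃ C : V → Set V, (∀ a ∈ innerBoundary G A, a ∈ C a ∧ C a ⊆ B ∧ C a ∩ A ⊆ {a} ∧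
    (G.induce (C a)).Connected ∧ ∃ b ∈ innerBoundary G B, b ∈ C a) ∧
    ∀ a ∈ innerBoundary G A, ∀ a' ∈ innerBoundary G A, a ≠ a' → Disjoint (C a) (C a')

/-- The sets of the second linkage meet `Z` only in their starting points, so they can be attached
to those of the first without new intersections. -/
lemma Linked.trans {A Z B : Set V} (hAZ : A ⊆ Z) (hZB : Z ⊆ B) (h₁ : Linked G A Z)
    (h₂ : Linked G Z B) : Linked G A B := by
  classical
  obtain ⟨C, hC, hCd⟩ := h₁
  obtain ⟨D, hD, hDd⟩ := h₂
  have : ∀ a, ∃ z, a ∈ innerBoundary G A → z ∈ innerBoundary G Z ∧ z ∈ C a := by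
    intro a
    by_cases ha : a ∈ innerBoundary G A
    · obtain ⟨z, hz, hz'⟩ := (hC a ha).2.2.2.2
      exact ⟨z, fun _ => ⟨hz, hz'⟩⟩
    · exact ⟨a, fun h => absurd h ha⟩
  choose z hz using this
  have hCD : ∀ a ∈ innerBoundary G A, ∀ a' ∈ innerBoundary G A, a ≠ a' →
      Disjoint (C a) (D (z a')) := by
    intro a ha a' ha' hne
    rw [Set.disjoint_left]
    intro y hy hy'
    obtain rfl : y = z a' := (hD _ (hz a' ha').1).2.2.1 ⟨hy', (hC a ha).2.1 hy⟩
    exact Set.disjoint_left.1 (hCd a ha a' ha' hne) hy (hz a' ha').2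
  refine ⟨fun a => C a ∪ D (z a), fun a ha => ⟨.inl (hC a ha).1, ?_, ?_, ?_, ?_⟩, ?_⟩
  · exact Set.union_subset ((hC a ha).2.1.trans hZB) (hD _ (hz a ha).1).2.1
  · rintro y ⟨hy | hy, hyA⟩
    · exact (hC a ha).2.2.1 ⟨hy, hyA⟩
    · obtain rfl : y = z a := (hD _ (hz a ha).1).2.2.1 ⟨hy, hAZ hyA⟩
      exact (hC a ha).2.2.1 ⟨(hz a ha).2, hyA⟩
  · exact SimpleGraph.induce_union_connected (hC a ha).2.2.2.1.1 (hD _ (hz a ha).1).2.2.2.1.1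
      ⟨z a, (hz a ha).2, (hD _ (hz a ha).1).1⟩
  · obtain ⟨b, hb, hb'⟩ := (hD _ (hz a ha).1).2.2.2.2
    exact ⟨b, hb, .inr hb'⟩
  · intro a ha a' ha' hne
    rw [Set.disjoint_union_left, Set.disjoint_union_right, Set.disjoint_union_right]
    refine ⟨⟨hCd a ha a' ha' hne, hCD a ha a' ha' hne⟩, (hCD a' ha' a ha hne.symm).symm, ?_⟩
    refine hDd _ (hz a ha).1 _ (hz a' ha').1 fun h => ?_
    exact Set.disjoint_left.1 (hCd a ha a' ha' hne) (hz a ha).2 (h ▸ (hz a' ha').2)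

lemma Linked.of_subset {A B : Set V} (hAB : A ⊆ B) (h : innerBoundary G A ⊆ innerBoundary G B) :
    Linked G A B := by
  refine ⟨fun a => {a}, fun a ha => ⟨rfl, ?_, fun x hx => hx.1, ?_, a, h ha, rfl⟩, ?_⟩
  · rintro _ rfl
    exact hAB ha.1
  · exact connected_induce_singleton a
  · intro a _ a' _ hne
    simpa using hne

lemma connected_induce_mono {G' : SimpleGraph V} (h : G' ≤ G) {s : Set V}
    (hs : (G'.induce s).Connected) : (G.induce s).Connected :=
  hs.mono fun _ _ hab => h hab

/-- Menger's theorem, for nested sets of vertices. -/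
theorem linked_of_forall_le [Finite V] {A B : Set V} (hAB : A ⊆ B)
    (hcard : (innerBoundary G B).ncard = (innerBoundary G A).ncard)
    (hmin : ∀ Z, A ⊆ Z → Z ⊆ B → (innerBoundary G A).ncard ≤ (innerBoundary G Z).ncard) :
    Linked G A B := by
  classical
  induction hn : G.edgeSet.ncard + (B \ A).ncard using Nat.strong_induction_on
    generalizing G A B with
  | _ n ih =>
  subst hn
  by_cases hsplit : ∃ Z, A ⊆ Z ∧ Z ⊆ B ∧ Z ≠ A ∧ Z ≠ B ∧
      (innerBoundary G Z).ncard = (innerBoundary G A).ncard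
  · obtain ⟨Z, hAZ, hZB, hZA, hZB', hZ⟩ := hsplit
    obtain ⟨x, hx, hx'⟩ := Set.exists_of_ssubset (hAZ.ssubset_of_ne hZA.symm)
    obtain ⟨y, hy, hy'⟩ := Set.exists_of_ssubset (hZB.ssubset_of_ne hZB')
    refine Linked.trans hAZ hZB (ih _ ?_ hAZ hZ (fun W h₁ h₂ => hmin W h₁ (h₂.trans hZB)) rfl)
      (ih _ ?_ hZB (hcard.trans hZ.symm)
        (fun W h₁ h₂ => hZ ▸ hmin W (hAZ.trans h₁) h₂) rfl)
    · refine Nat.add_lt_add_left (Set.ncard_lt_ncard ?_) _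
      exact ⟨fun z hz => ⟨hZB hz.1, hz.2⟩, fun h => hy' (h ⟨hy, fun h => hy' (hAZ h)⟩).1⟩
    · refine Nat.add_lt_add_left (Set.ncard_lt_ncard ?_) _
      exact ⟨fun z hz => ⟨hz.1, fun h => hz.2 (hAZ h)⟩, fun h => (h ⟨hZB hx, hx'⟩).2 hx⟩
  by_cases hsub : innerBoundary G A ⊆ innerBoundary G B
  · exact .of_subset hAB hsub
  obtain ⟨a, ha, haB⟩ := Set.not_subset.1 hsub
  obtain ⟨haA, v, hvA, hav⟩ := ha
  have hvB : v ∈ B := by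
    by_contra h
    exact haB ⟨hAB haA, v, h, hav⟩
  -- Either minimality survives the deletion of this edge and induction applies, or a set `Z`
  -- violates it. In the second case `Z` has a boundary of minimum size in `G`, and having no proper
  -- intermediate set of that kind forces `Z = A`, then `B = A ∪ {v}`.
  set G' := G.deleteEdges {s(a, v)} with hG'
  have hle : G' ≤ G := SimpleGraph.deleteEdges_le _
  have hG'adj : ∀ x y, G.Adj x y → s(x, y) ≠ s(a, v) → G'.Adj x y := by
    intro x y hxy hne
    rw [hG', SimpleGraph.deleteEdges_adj]
    exact ⟨hxy, hne⟩
  by_cases hG'min : ∀ Z, A ⊆ Z → Z ⊆ B → (innerBoundary G A).ncard ≤ (innerBoundary G' Z).ncard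
  · have hA : innerBoundary G' A = innerBoundary G A :=
      Set.eq_of_subset_of_ncard_le (innerBoundary_mono_graph hle A) (hG'min A subset_rfl hAB)
    have hB : innerBoundary G' B = innerBoundary G B :=
      Set.eq_of_subset_of_ncard_le (innerBoundary_mono_graph hle B)
        (hcard ▸ hG'min B hAB subset_rfl)
    have hlt : G'.edgeSet.ncard < G.edgeSet.ncard := by
      refine Set.ncard_lt_ncard ⟨SimpleGraph.edgeSet_mono hle, fun h => ?_⟩ (Set.toFinite _)
      have : s(a, v) ∈ G'.edgeSet := h hav
      simp [hG'] at this
    obtain ⟨C, hC, hCd⟩ := ih _ (Nat.add_lt_add_right hlt _) hAB (by rw [hA, hB, hcard])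
      (by rw [hA]; exact hG'min) rfl
    rw [hA] at hC hCd
    rw [hB] at hC
    exact ⟨C, fun x hx => ⟨(hC x hx).1, (hC x hx).2.1, (hC x hx).2.2.1,
      connected_induce_mono hle (hC x hx).2.2.2.1, (hC x hx).2.2.2.2⟩, hCd⟩
  push Not at hG'min
  obtain ⟨Z, hAZ, hZB, hZ⟩ := hG'min
  have hZsub : innerBoundary G Z ⊆ insert a (innerBoundary G' Z) := by
    rintro x ⟨hx, y, hy, hxy⟩
    by_cases hxa : x = a
    · exact .inl hxa
    · refine .inr ⟨hx, y, hy, hG'adj x y hxy fun h => ?_⟩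
      rcases Sym2.eq_iff.1 h with h | h
      · exact hxa h.1
      · exact hy (h.2 ▸ hAZ haA)
  have hZcard : (innerBoundary G Z).ncard = (innerBoundary G A).ncard := by
    refine le_antisymm ?_ (hmin Z hAZ hZB)
    exact (Set.ncard_le_ncard hZsub).trans ((Set.ncard_insert_le _ _).trans hZ)
  have hvZ : v ∉ Z := by
    intro hv
    refine absurd (hmin Z hAZ hZB) (not_le.2 (lt_of_le_of_lt (Set.ncard_le_ncard ?_) hZ))
    rintro x ⟨hx, y, hy, hxy⟩
    refine ⟨hx, y, hy, hG'adj x y hxy fun h => ?_⟩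
    rcases Sym2.eq_iff.1 h with h | h
    · exact hy (h.2 ▸ hv)
    · exact hy (h.2 ▸ hAZ haA)
  obtain rfl : Z = A := by
    by_contra h
    exact hsplit ⟨Z, hAZ, hZB, h, fun h' => hvZ (h' ▸ hvB), hZcard⟩
  -- Deleting the edge removes `a` from the boundary, so `v` is its only neighbour outside. Hence
  -- adding `v` trades `a` for `v` in the boundary.
  have hav' : ∀ y, y ∉ Z → G.Adj a y → y = v := by
    intro y hy hay
    by_contra hyv
    refine absurd (Set.ncard_le_ncard (hZsub.trans (Set.insert_subset ?_ subset_rfl)))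
      (not_le.2 hZ)
    refine ⟨haA, y, hy, hG'adj a y hay fun h => ?_⟩
    rcases Sym2.eq_iff.1 h with h | h
    · exact hyv h.2
    · exact hy (h.2 ▸ haA)
  have hsub' : innerBoundary G (insert v Z) ⊆ insert v (innerBoundary G Z \ {a}) := by
    rintro x ⟨rfl | hx, y, hy, hxy⟩
    · exact .inl rfl
    · refine .inr ⟨⟨hx, y, fun h => hy (.inr h), hxy⟩, ?_⟩
      rintro rfl
      exact hy (.inl (hav' y (fun h => hy (.inr h)) hxy))
  have hcard' : (insert v (innerBoundary G Z \ {a})).ncard ≤ (innerBoundary G Z).ncard := by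
    refine (Set.ncard_insert_le _ _).trans (le_of_eq ?_)
    exact Set.ncard_sdiff_singleton_add_one (show a ∈ innerBoundary G Z from ⟨haA, v, hvA, hav⟩)
  have hZv : insert v Z ⊆ B := Set.insert_subset hvB hAB
  obtain rfl : insert v Z = B := by
    by_contra h
    refine hsplit ⟨insert v Z, Set.subset_insert _ _, hZv, fun h' => ?_, h, ?_⟩
    · exact hvA (h' ▸ Set.mem_insert v Z)
    · exact le_antisymm ((Set.ncard_le_ncard hsub').trans hcard')
        (hmin _ (Set.subset_insert _ _) hZv)
  have hB := Set.eq_of_subset_of_ncard_le hsub' (hcard'.trans hcard.ge)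
  refine ⟨fun x => if x = a then {a, v} else {x}, fun x hx => ?_, fun x hx y hy hne => ?_⟩
  · by_cases hxa : x = a
    · subst hxa
      beta_reduce
      rw [if_pos rfl]
      refine ⟨.inl rfl, ?_, ?_, SimpleGraph.induce_pair_connected_of_adj hav, v, ?_, .inr rfl⟩
      · rintro _ (rfl | rfl)
        · exact .inr haA
        · exact .inl rfl
      · rintro _ ⟨rfl | rfl, h⟩
        · rfl
        · exact absurd h hvA
      · rw [hB]
        exact .inl rfl
    · beta_reduce
      rw [if_neg hxa]
      refine ⟨rfl, ?_, fun y hy => hy.1, connected_induce_singleton x, x, ?_, rfl⟩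
      · rintro _ rfl
        exact .inr hx.1
      · rw [hB]
        exact .inr ⟨hx, hxa⟩
  · have hxv : x ≠ v := fun h => hvA (h ▸ hx.1)
    have hyv : y ≠ v := fun h => hvA (h ▸ hy.1)
    rw [Set.disjoint_left]
    intro z hz hz'
    dsimp only at hz hz'
    split_ifs at hz hz' with h₁ h₂ h₂
    · exact hne (h₁.trans h₂.symm)
    · rcases hz with rfl | rfl
      · exact h₂ hz'.symm
      · exact hyv hz'.symm
    · rcases hz' with rfl | rfl
      · exact h₁ hz.symm
      · exact hxv hz.symm
    · exact hne (hz.symm.trans hz')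

/-! ### Large pathwidth forces tree minors -/

/-- Sets that are reached from the empty set by adding vertices one at a time, with boundaries of
at most `n` vertices throughout. -/
inductive Sweepable (G : SimpleGraph V) (n : ℕ) : Set V → Prop
  | nil : Sweepable G n ∅
  | cons {X : Set V} {x : V} : Sweepable G n X → x ∉ X →
      (innerBoundary G (insert x X)).ncard ≤ n → Sweepable G n (insert x X)

/-- Intersect each stage of the sweep with `Y`. By submodularity the boundary does not grow, since
adding the stage to `Y` cannot shrink the boundary of `Y`. -/
lemma Sweepable.inter [Finite V] {n : ℕ} {X Y : Set V} (hX : Sweepable G n X)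
    (hY : ∀ Z, Y ⊆ Z → Z ⊆ X ∪ Y → (innerBoundary G Y).ncard ≤ (innerBoundary G Z).ncard) :
    Sweepable G n (X ∩ Y) := by
  induction hX with
  | nil => simpa using Sweepable.nil
  | @cons X x hX hx hn ih =>
    have ih := ih fun Z h₁ h₂ =>
      hY Z h₁ (h₂.trans (Set.union_subset_union_left _ (Set.subset_insert _ _)))
    by_cases hxY : x ∈ Y
    · have h₁ := ncard_innerBoundary_submodular (G := G) (insert x X) Y
      have h₂ := hY (insert x X ∪ Y) Set.subset_union_right subset_rfl
      rw [Set.insert_inter_of_mem hxY] at h₁ ⊢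
      exact .cons ih (fun h => hx h.1) (by omega)
    · rwa [Set.insert_inter_of_notMem hxY]

/-- Each new vertex `x` creates the bag of `x` and the current boundary, which contains all earlier
neighbours of `x`. Keeping the boundary inside the last bag is what makes the bags convex. -/
lemma Sweepable.exists_bags {n : ℕ} {X : Set V} (hX : Sweepable G n X)
    [Finite V] : ∃ (N : ℕ) (B : ℕ → Set V), (∀ i x, x ∈ B i → i ≤ N ∧ x ∈ X) ∧
      innerBoundary G X ⊆ B N ∧ (∀ x ∈ X, ∃ i, x ∈ B i) ∧
      (∀ x ∈ X, ∀ y ∈ X, G.Adj x y → ∃ i, x ∈ B i ∧ y ∈ B i) ∧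
      (∀ {i j k : ℕ} {x : V}, i ≤ j → j ≤ k → x ∈ B i → x ∈ B k → x ∈ B j) ∧
      (∀ i, (B i).ncard ≤ n + 1) ∧ (innerBoundary G X).ncard ≤ n := by
  induction hX with
  | nil => exact ⟨0, fun _ => ∅, by simp, by simp [innerBoundary], by simp, by simp, by simp,
      by simp, by simp [innerBoundary]⟩
  | @cons X x hX hx hn ih =>
    obtain ⟨N, B, hB, hbd, hcov, hedge, hconv, hcard, hXn⟩ := ih
    set B' : ℕ → Set V := fun i => if i = N + 1 then insert x (innerBoundary G X) else B i with hB'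
    have hlast : B' (N + 1) = insert x (innerBoundary G X) := by simp [hB']
    have hold : ∀ {i y}, y ∈ B i → y ∈ B' i := by
      intro i y hy
      have := (hB i y hy).1
      simpa [hB', show i ≠ N + 1 by omega] using hy
    have hedge' : ∀ y ∈ X, G.Adj x y → ∃ i, x ∈ B' i ∧ y ∈ B' i := by
      intro y hy hxy
      refine ⟨N + 1, ?_, ?_⟩
      · rw [hlast]
        exact .inl rfl
      · rw [hlast]
        exact .inr ⟨hy, x, hx, hxy.symm⟩
    refine ⟨N + 1, B', ?_, ?_, ?_, ?_, ?_, ?_, hn⟩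
    · intro i y hy
      simp only [hB'] at hy
      split_ifs at hy with h
      · refine ⟨h.le, ?_⟩
        rcases hy with rfl | hy
        · exact .inl rfl
        · exact .inr hy.1
      · have := hB i y hy
        exact ⟨by omega, .inr this.2⟩
    · rw [hlast]
      exact innerBoundary_insert_subset x X
    · rintro y (rfl | hy)
      · exact ⟨N + 1, by rw [hlast]; exact .inl rfl⟩
      · obtain ⟨i, hi⟩ := hcov y hy
        exact ⟨i, hold hi⟩
    · rintro y (rfl | hy) z (rfl | hz) hyz
      · exact absurd hyz (G.irrefl)
      · exact hedge' z hz hyz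
      · obtain ⟨i, h₁, h₂⟩ := hedge' y hy hyz.symm
        exact ⟨i, h₂, h₁⟩
      · obtain ⟨i, h₁, h₂⟩ := hedge y hy z hz hyz
        exact ⟨i, hold h₁, hold h₂⟩
    · intro i j k y hij hjk hi hk
      by_cases hk' : k = N + 1
      · subst hk'
        by_cases hi' : i = N + 1
        · obtain rfl : i = j := by omega
          exact hi
        · simp only [hB', hi', if_false] at hi
          have hyi := hB i y hi
          rw [hlast] at hk
          obtain rfl | hk := hk
          · exact absurd hyi.2 hx
          · by_cases hj' : j = N + 1
            · rw [hj', hlast]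
              exact .inr hk
            · exact hold (hconv hij (show j ≤ N by omega) hi (hbd hk))
      · simp only [hB', hk', if_false] at hk
        have hk'' := (hB k y hk).1
        simp only [hB', show i ≠ N + 1 by omega, if_false] at hi
        exact hold (hconv hij hjk hi hk)
    · intro i
      simp only [hB']
      split_ifs
      · exact (Set.ncard_insert_le _ _).trans (by omega)
      · exact hcard i

lemma Sweepable.exists_pathBags [Finite V] {n : ℕ} (h : Sweepable G n Set.univ) :
    ∃ B, PathBags G (n + 1) B := by
  obtain ⟨N, B, hB, -, hcov, hedge, hconv, hcard, -⟩ := h.exists_bags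
  refine ⟨B, hconv, fun h => hedge _ trivial _ trivial h, fun x => hcov x trivial,
    ⟨N, fun i x hx => (hB i x hx).1⟩, fun i => ?_⟩
  rw [← Set.Finite.cast_ncard_eq (Set.toFinite _)]
  exact_mod_cast hcard i

/-- A model in `G` of the tree on `{0, …, n - 1}` in which `i + 1` is a child of `π (i + 1)`. -/
structure IsTreeModel (G : SimpleGraph V) (π : ℕ → ℕ) (n : ℕ) (M : ℕ → Set V) : Prop where
  connected : ∀ i < n, (G.induce (M i)).Connected
  disjoint : ∀ i < n, ∀ j < n, i ≠ j → Disjoint (M i) (M j)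
  adj : ∀ i, i + 1 < n → ∃ x ∈ M (i + 1), ∃ y ∈ M (π (i + 1)), G.Adj x y

/-- A tree model in `X` each part of which contains exactly one boundary vertex. -/
structure IsBoundaryModel (G : SimpleGraph V) (π : ℕ → ℕ) (n : ℕ) (X : Set V) (M : ℕ → Set V)
    (s : ℕ → V) : Prop extends IsTreeModel G π n M where
  subset : ∀ i < n, M i ⊆ X
  mem : ∀ i < n, s i ∈ M i
  boundary : innerBoundary G X = s '' {i | i < n}

lemma ncard_setOf_lt (n : ℕ) : {i : ℕ | i < n}.ncard = n := by
  rw [show {i : ℕ | i < n} = ↑(Finset.range n) from by ext; simp, Set.ncard_coe_finset,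
    Finset.card_range]

/-- Extend each part along the linked set that starts at its boundary vertex; these sets meet `A`
nowhere else, so the parts stay disjoint. -/
lemma IsBoundaryModel.of_linked [Finite V] {π : ℕ → ℕ} {n : ℕ} {A B : Set V} {M : ℕ → Set V}
    {s : ℕ → V} (hM : IsBoundaryModel G π n A M s) (hAB : A ⊆ B)
    (h : Linked G A B) (hcard : (innerBoundary G B).ncard ≤ n) :
    ∃ M' s', IsBoundaryModel G π n B M' s' := by
  classical
  obtain ⟨C, hC, hCd⟩ := h
  have hs : ∀ i < n, s i ∈ innerBoundary G A := fun i hi => hM.boundary ▸ ⟨i, hi, rfl⟩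
  have hinj : ∀ i < n, ∀ j < n, i ≠ j → s i ≠ s j := fun i hi j hj hij h =>
    Set.disjoint_left.1 (hM.disjoint i hi j hj hij) (hM.mem i hi) (h ▸ hM.mem j hj)
  have : ∀ i, ∃ b, i < n → b ∈ innerBoundary G B ∧ b ∈ C (s i) := by
    intro i
    by_cases hi : i < n
    · obtain ⟨b, hb, hb'⟩ := (hC _ (hs i hi)).2.2.2.2
      exact ⟨b, fun _ => ⟨hb, hb'⟩⟩
    · exact ⟨s i, fun h => absurd h hi⟩
  choose t ht using this
  have hMC : ∀ i < n, ∀ j < n, i ≠ j → Disjoint (M i) (C (s j)) := by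
    intro i hi j hj hij
    rw [Set.disjoint_left]
    intro y hy hy'
    obtain rfl : y = s j := (hC _ (hs j hj)).2.2.1 ⟨hy', hM.subset i hi hy⟩
    exact Set.disjoint_left.1 (hM.disjoint i hi j hj hij) hy (hM.mem j hj)
  refine ⟨fun i => M i ∪ C (s i), t, ⟨⟨fun i hi => ?_, fun i hi j hj hij => ?_, fun i hi => ?_⟩,
    fun i hi => ?_, fun i hi => .inr (ht i hi).2, ?_⟩⟩
  · exact SimpleGraph.induce_union_connected (hM.connected i hi).1 (hC _ (hs i hi)).2.2.2.1.1
      ⟨s i, hM.mem i hi, (hC _ (hs i hi)).1⟩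
  · rw [Set.disjoint_union_left, Set.disjoint_union_right, Set.disjoint_union_right]
    exact ⟨⟨hM.disjoint i hi j hj hij, hMC i hi j hj hij⟩, (hMC j hj i hi hij.symm).symm,
      hCd _ (hs i hi) _ (hs j hj) (hinj i hi j hj hij)⟩
  · obtain ⟨x, hx, y, hy, hxy⟩ := hM.adj i hi
    exact ⟨x, .inl hx, y, .inl hy, hxy⟩
  · exact Set.union_subset ((hM.subset i hi).trans hAB) (hC _ (hs i hi)).2.1
  · symm
    refine Set.eq_of_subset_of_ncard_le ?_ ?_
    · rintro _ ⟨i, hi, rfl⟩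
      exact (ht i hi).1
    · rw [Set.InjOn.ncard_image]
      · exact hcard.trans (ncard_setOf_lt n).ge
      · intro i hi j hj hij
        by_contra hne
        exact Set.disjoint_left.1 (hCd _ (hs i hi) _ (hs j hj) (hinj i hi j hj hne))
          (ht i hi).2 (hij ▸ (ht j hj).2)

/-- Bienstock, Robertson, Seymour and Thomas: a graph of large pathwidth contains every tree with
few vertices as a minor. The proof is Diestel's. -/
theorem sweepable_or_exists_treeModel [Finite V] (G : SimpleGraph V) {π : ℕ → ℕ}
    (hπ : ∀ i, π (i + 1) ≤ i) (n : ℕ) :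
    Sweepable G n Set.univ ∨ ∃ M, IsTreeModel G π n M := by
  classical
  by_contra! hcon
  obtain ⟨huniv, hmodel⟩ := hcon
  have hmaximal : ∀ k A, Sweepable G n A → (innerBoundary G A).ncard ≤ k →
      ∃ B, A ⊆ B ∧ Sweepable G n B ∧ (innerBoundary G B).ncard ≤ k ∧
        ∀ Y, B ⊆ Y → Sweepable G n Y → (innerBoundary G Y).ncard ≤ k → Y = B := by
    intro k A hA hAk
    obtain ⟨B, hAB, hB⟩ := (Set.toFinite {Y : Set V | Sweepable G n Y ∧
      (innerBoundary G Y).ncard ≤ k}).exists_le_maximal ⟨hA, hAk⟩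
    exact ⟨B, hAB, hB.1.1, hB.1.2, fun Y hBY hY hYk => (hB.2 ⟨hY, hYk⟩ hBY).antisymm hBY⟩
  -- The tree is built node by node. Maximality of `X` is the invariant that later excludes small
  -- boundaries and so makes Menger's theorem applicable.
  have main : ∀ i ≤ n, ∃ X M s, Sweepable G n X ∧ IsBoundaryModel G π i X M s ∧
      ∀ Y, X ⊆ Y → Sweepable G n Y → (innerBoundary G Y).ncard ≤ i → Y = X := by
    intro i
    induction i with
    | zero =>
      intro _
      obtain ⟨B, -, hB, hB0, hmax⟩ := hmaximal 0 ∅ .nil (by simp [innerBoundary])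
      have hB0' : innerBoundary G B = ∅ := (Set.ncard_eq_zero).1 (by omega)
      have hV : Nonempty V := by
        by_contra h
        rw [not_nonempty_iff] at h
        exact huniv (Set.eq_empty_of_isEmpty (Set.univ : Set V) ▸ .nil)
      exact ⟨B, fun _ => ∅, fun _ => hV.some, hB, ⟨⟨by simp, by simp, by simp⟩, by simp, by simp,
        by simp [hB0']⟩, hmax⟩
    | succ i ih =>
      intro hin
      obtain ⟨X, M, s, hX, hM, hmax⟩ := ih (by omega)
      have hXi : (innerBoundary G X).ncard ≤ i := by
        rw [hM.boundary]
        exact (Set.ncard_image_le (Set.finite_lt_nat i)).trans (ncard_setOf_lt i).le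
      -- The new node is a vertex outside `X` next to the boundary vertex of the parent part. The
      -- condition is vacuous for `i = 0`, as the root has no parent.
      obtain ⟨x, hx, hxadj⟩ : ∃ x, x ∉ X ∧ ∀ j, j + 1 = i → G.Adj x (s (π i)) := by
        rcases i with - | i
        · by_contra! h
          have hXuniv : X = Set.univ := by
            refine Set.eq_univ_of_forall fun x => ?_
            by_contra hx
            obtain ⟨j, hj, -⟩ := h x hx
            omega
          exact huniv (hXuniv ▸ hX)
        · have : s (π (i + 1)) ∈ innerBoundary G X := by
            rw [hM.boundary]
            exact ⟨_, Nat.lt_succ_of_le (hπ i), rfl⟩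
          obtain ⟨-, y, hy, hy'⟩ := this
          exact ⟨y, hy, fun _ _ => hy'.symm⟩
      have hbdA := innerBoundary_insert_subset (G := G) x X
      have hcardle : (insert x (innerBoundary G X)).ncard ≤ i + 1 :=
        (Set.ncard_insert_le _ _).trans (by omega)
      have hAi : (innerBoundary G (insert x X)).ncard ≤ i + 1 :=
        (Set.ncard_le_ncard hbdA).trans hcardle
      have hA : Sweepable G n (insert x X) := .cons hX hx (by omega)
      obtain ⟨B, hAB, hB, hBi, hBmax⟩ := hmaximal (i + 1) _ hA hAi
      -- A set of minimum boundary between `insert x X` and `B` is sweepable by `Sweepable.inter`.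
      -- With boundary at most `i` it would contradict the maximality of `X`.
      have hlow : ∀ Z, insert x X ⊆ Z → Z ⊆ B → i + 1 ≤ (innerBoundary G Z).ncard := by
        obtain ⟨Z₀, hZ₀, hZmin⟩ := Set.exists_min_image {Z | insert x X ⊆ Z ∧ Z ⊆ B}
          (fun Z => (innerBoundary G Z).ncard) (Set.toFinite _) ⟨_, subset_rfl, hAB⟩
        have hgood : Sweepable G n Z₀ := by
          have := hB.inter (Y := Z₀) fun Z h₁ h₂ => hZmin Z ⟨hZ₀.1.trans h₁, by
            rwa [Set.union_eq_left.2 hZ₀.2] at h₂⟩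
          rwa [Set.inter_eq_right.2 hZ₀.2] at this
        by_contra! h
        obtain ⟨Z, h₁, h₂, h₃⟩ := h
        have := hZmin Z ⟨h₁, h₂⟩
        have hZX := hmax Z₀ ((Set.subset_insert _ _).trans hZ₀.1) hgood (by omega)
        exact hx (hZX ▸ hZ₀.1 (Set.mem_insert _ _))
      have hAeq : (innerBoundary G (insert x X)).ncard = i + 1 :=
        le_antisymm hAi (hlow _ subset_rfl hAB)
      have hBeq : (innerBoundary G B).ncard = i + 1 :=
        le_antisymm hBi (hlow _ hAB subset_rfl)
      have hbdA' := Set.eq_of_subset_of_ncard_le hbdA (hcardle.trans hAeq.ge)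
      have hlink := linked_of_forall_le hAB (hBeq.trans hAeq.symm) (by rwa [hAeq])
      have hM' : IsBoundaryModel G π (i + 1) (insert x X) (fun j => if j = i then {x} else M j)
          (fun j => if j = i then x else s j) := by
        have hxM : ∀ j < i, x ∉ M j := fun j hj h => hx (hM.subset j hj h)
        refine ⟨⟨fun j hj => ?_, fun j hj k hk hjk => ?_, fun j hj => ?_⟩, fun j hj => ?_,
          fun j hj => ?_, ?_⟩
        · by_cases h : j = i
          · rw [if_pos h]
            exact connected_induce_singleton x
          · rw [if_neg h]
            exact hM.connected j (by omega)
        · split_ifs with h₁ h₂ h₂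
          · omega
          · simpa using hxM k (by omega)
          · simpa using hxM j (by omega)
          · exact hM.disjoint j (by omega) k (by omega) hjk
        · have hπj := hπ j
          rw [if_neg (show π (j + 1) ≠ i by omega)]
          split_ifs with h
          · subst h
            exact ⟨x, rfl, _, hM.mem _ (by omega), hxadj j rfl⟩
          · exact hM.adj j (by omega)
        · split_ifs with h
          · simp
          · exact (hM.subset j (by omega)).trans (Set.subset_insert _ _)
        · split_ifs with h
          · rfl
          · exact hM.mem j (by omega)
        · rw [hbdA', hM.boundary]
          ext y
          constructor
          · rintro (rfl | ⟨j, hj, rfl⟩)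
            · exact ⟨i, Nat.lt_succ_self i, by simp⟩
            · exact ⟨j, Nat.lt_succ_of_lt hj, by simp [(show j < i from hj).ne]⟩
          · rintro ⟨j, hj, rfl⟩
            dsimp only
            split_ifs with h
            · exact .inl rfl
            · exact .inr ⟨j, lt_of_le_of_ne (Nat.lt_succ_iff.1 hj) h, rfl⟩
      obtain ⟨M', s', hBM⟩ := hM'.of_linked hAB hlink hBi
      exact ⟨B, M', s', hB, hBM, hBmax⟩
  obtain ⟨X, M, s, -, hM, -⟩ := main n le_rfl
  exact hmodel M hM.toIsTreeModel

/-! ### Tree models inside annuli -/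

lemma IsTreeModel.connected_iUnion {π : ℕ → ℕ} (hπ : ∀ i, π (i + 1) ≤ i) {n : ℕ} {M : ℕ → Set V}
    (hM : IsTreeModel G π (n + 1) M) :
    (G.induce (⋃ i, ⋃ (_ : i < n + 1), M i)).Connected := by
  induction n with
  | zero =>
    rw [show (⋃ i, ⋃ (_ : i < 0 + 1), M i) = M 0 by ext; simp]
    exact hM.connected 0 (by simp)
  | succ n ih =>
    have ih := ih ⟨fun i hi => hM.connected i (by omega),
      fun i hi j hj => hM.disjoint i (by omega) j (by omega), fun i hi => hM.adj i (by omega)⟩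
    obtain ⟨x, hx, y, hy, hxy⟩ := hM.adj n (by omega)
    rw [show (⋃ i, ⋃ (_ : i < n + 1 + 1), M i) =
      (⋃ i, ⋃ (_ : i < n + 1), M i) ∪ M (n + 1) from Set.biUnion_lt_succ M (n + 1)]
    refine SimpleGraph.connected_induce_union ih.1 (hM.connected _ (by omega)).1
      (Set.mem_iUnion₂.2 ⟨π (n + 1), Nat.lt_succ_of_le (hπ n), hy⟩) hx hxy.symm

/-- The tree obtained from the tree `π` by replacing all nodes by copies of the tree `κ` on
`m` nodes. -/
def blowUp (π κ : ℕ → ℕ) (m i : ℕ) : ℕ :=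
  if i % m = 0 then π (i / m) * m else i / m * m + κ (i % m)

lemma blowUp_mul {π κ : ℕ → ℕ} {m : ℕ} (hm : 0 < m) (i : ℕ) :
    blowUp π κ m (i * m) = π i * m := by
  simp [blowUp, Nat.mul_div_cancel _ hm]

lemma blowUp_add {π κ : ℕ → ℕ} {m : ℕ} (i : ℕ) {k : ℕ} (hk : k + 1 < m) :
    blowUp π κ m (i * m + (k + 1)) = i * m + κ (k + 1) := by
  have h₁ : (i * m + (k + 1)) % m = k + 1 := by
    rw [add_comm, Nat.add_mul_mod_self_right, Nat.mod_eq_of_lt hk]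
  have h₂ : (i * m + (k + 1)) / m = i := by
    rw [add_comm, Nat.add_mul_div_right _ _ (by omega), Nat.div_eq_of_lt hk, zero_add]
  rw [blowUp, h₁, h₂, if_neg (Nat.succ_ne_zero k)]

lemma blowUp_le {π κ : ℕ → ℕ} {m : ℕ} (hm : 0 < m) (hπ : ∀ i, π (i + 1) ≤ i)
    (hκ : ∀ i, κ (i + 1) ≤ i) (i : ℕ) : blowUp π κ m (i + 1) ≤ i := by
  have hdiv := Nat.div_add_mod (i + 1) m
  rw [mul_comm] at hdiv
  unfold blowUp
  split_ifs with h
  · rw [h] at hdiv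
    obtain ⟨q, hq⟩ : ∃ q, (i + 1) / m = q + 1 := by
      refine Nat.exists_eq_succ_of_ne_zero fun h0 => ?_
      rw [h0] at hdiv
      omega
    rw [hq] at hdiv ⊢
    have := Nat.mul_le_mul_right m (hπ q)
    rw [add_mul] at hdiv
    omega
  · obtain ⟨k, hk⟩ := Nat.exists_eq_succ_of_ne_zero h
    rw [hk] at hdiv ⊢
    have := hκ k
    rw [Nat.succ_eq_add_one] at *
    omega

lemma mul_add_lt_mul {n m i k : ℕ} (hi : i < n) (hk : k < m) : i * m + k < n * m :=
  calc i * m + k < i * m + m := by omega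
    _ = (i + 1) * m := by ring
    _ ≤ n * m := Nat.mul_le_mul_right m hi

/-- For every tree and every width there is a larger tree such that every model of it in an annulus
yields a model of the given tree above some layer, all of whose parts meet that layer. -/
lemma exists_tree_forall_model (π : ℕ → ℕ) (hπ : ∀ i, π (i + 1) ≤ i) {n : ℕ} (hn : 0 < n) (w : ℕ) :
    ∃ (κ : ℕ → ℕ) (m : ℕ), (∀ i, κ (i + 1) ≤ i) ∧ 0 < m ∧
      ∀ (V : Type u) (G : SimpleGraph V) (L : V → ℕ) (a : ℕ) (M : ℕ → Set V),
        IsTreeModel G κ m M → (∀ i < m, ∀ x ∈ M i, a ≤ L x ∧ L x ≤ a + w) →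
        ∃ (c : ℕ) (M' : ℕ → Set V), IsTreeModel G π n M' ∧
          (∀ i < n, ∀ x ∈ M' i, c ≤ L x) ∧ ∀ i < n, ∃ x ∈ M' i, L x = c := by
  induction w with
  | zero =>
    refine ⟨π, n, hπ, hn, fun V G L a M hM hL => ⟨a, M, hM, fun i hi x hx => (hL i hi x hx).1,
      fun i hi => ?_⟩⟩
    obtain ⟨x, hx⟩ := (hM.connected i hi).nonempty
    have := hL i hi x hx
    exact ⟨x, hx, by omega⟩
  | succ w ih =>
    obtain ⟨κ, m, hκ, hm, ih⟩ := ih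
    refine ⟨blowUp π κ m, n * m, blowUp_le hm hπ hκ, Nat.mul_pos hn hm,
      fun V G L a M hM hL => ?_⟩
    have hcopy : ∀ i < n, IsTreeModel G κ m (fun k => M (i * m + k)) := by
      intro i hi
      refine ⟨fun k hk => hM.connected _ (mul_add_lt_mul hi hk), fun k hk l hl hkl =>
        hM.disjoint _ (mul_add_lt_mul hi hk) _ (mul_add_lt_mul hi hl) (by omega), fun k hk => ?_⟩
      have := hM.adj (i * m + k) (mul_add_lt_mul hi hk)
      rwa [add_assoc, blowUp_add i hk] at this
    -- If every copy of `κ` reaches the lowest layer `a`, the copies contract to a model of `π`.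
    -- Otherwise some copy lies in an annulus with one layer less.
    by_cases hcase : ∀ i < n, ∃ k < m, ∃ x ∈ M (i * m + k), L x = a
    · refine ⟨a, fun i => ⋃ k, ⋃ (_ : k < m), M (i * m + k),
        ⟨fun i hi => ?_, fun i hi j hj hij => ?_, fun i hi => ?_⟩, fun i hi x hx => ?_,
        fun i hi => ?_⟩
      · obtain ⟨m, rfl⟩ := Nat.exists_eq_succ_of_ne_zero hm.ne'
        exact (hcopy i hi).connected_iUnion hκ
      · rw [Set.disjoint_left]
        intro x hx hx'
        obtain ⟨k, hk, hx⟩ := Set.mem_iUnion₂.1 hx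
        obtain ⟨l, hl, hx'⟩ := Set.mem_iUnion₂.1 hx'
        refine Set.disjoint_left.1 (hM.disjoint _ (mul_add_lt_mul hi hk) _ (mul_add_lt_mul hj hl)
          fun h => hij ?_) hx hx'
        have := congrArg (· / m) h
        simpa [add_comm, Nat.add_mul_div_right _ _ hm, Nat.div_eq_of_lt hk,
          Nat.div_eq_of_lt hl] using this
      · have hpos : 0 < (i + 1) * m := Nat.mul_pos (Nat.succ_pos i) hm
        have := hM.adj ((i + 1) * m - 1) (by
          have := mul_add_lt_mul hi hm
          omega)
        rw [Nat.sub_add_cancel hpos, blowUp_mul hm] at this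
        obtain ⟨x, hx, y, hy, hxy⟩ := this
        exact ⟨x, Set.mem_iUnion₂.2 ⟨0, hm, hx⟩, y, Set.mem_iUnion₂.2 ⟨0, hm, hy⟩, hxy⟩
      · obtain ⟨k, hk, hx⟩ := Set.mem_iUnion₂.1 hx
        exact (hL _ (mul_add_lt_mul hi hk) x hx).1
      · obtain ⟨k, hk, x, hx, hxa⟩ := hcase i hi
        exact ⟨x, Set.mem_iUnion₂.2 ⟨k, hk, hx⟩, hxa⟩
    · push Not at hcase
      obtain ⟨i, hi, hi'⟩ := hcase
      refine ih V G L (a + 1) _ (hcopy i hi) fun k hk x hx => ?_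
      have := hL _ (mul_add_lt_mul hi hk) x hx
      have := hi' k hk x hx
      omega

lemma connected_induce_image_val {s : Set V} {M : Set s} (h : ((G.induce s).induce M).Connected) :
    (G.induce (Subtype.val '' M)).Connected := by
  let f : (G.induce s).induce M →g G.induce (Subtype.val '' M) :=
    ⟨fun x => ⟨x.1.1, x.1, x.2, rfl⟩, fun h => h⟩
  refine h.map f ?_
  rintro ⟨_, x, hx, rfl⟩
  exact ⟨⟨x, hx⟩, rfl⟩

lemma IsTreeModel.of_induce {s : Set V} {π : ℕ → ℕ} {n : ℕ} {M : ℕ → Set s}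
    (hM : IsTreeModel (G.induce s) π n M) :
    IsTreeModel G π n (fun i => Subtype.val '' M i) := by
  refine ⟨fun i hi => connected_induce_image_val (hM.connected i hi), fun i hi j hj hij =>
    (Set.disjoint_image_iff Subtype.val_injective).2 (hM.disjoint i hi j hj hij), fun i hi => ?_⟩
  obtain ⟨x, hx, y, hy, hxy⟩ := hM.adj i hi
  exact ⟨x, ⟨x, hx, rfl⟩, y, ⟨y, hy, rfl⟩, hxy⟩

/-! ### Apex-forest minors from breadth-first layerings -/

/-- Breadth-first layerings, with one root in each component. -/
lemma exists_bfs_layering (G : SimpleGraph V) : ∃ L : V → ℕ, IsLayering G L ∧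
    (∀ x, L x ≠ 0 → ∃ y, G.Adj x y ∧ L y + 1 = L x) ∧
    (∀ x y, G.Reachable x y → L x = 0 → L y = 0 → x = y) ∧
    ∀ x, ∃ r, G.Reachable x r ∧ L r = 0 := by
  set root : V → V := fun x => (G.connectedComponentMk x).out with hroot
  have hreach : ∀ x, G.Reachable (root x) x := fun x =>
    SimpleGraph.ConnectedComponent.exact (Quot.out_eq (G.connectedComponentMk x))
  have hroot' : ∀ x y, G.Reachable x y → root x = root y := fun x y h => by
    rw [hroot]
    dsimp only
    rw [SimpleGraph.ConnectedComponent.sound h]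
  have hzero : ∀ x, G.dist (root x) x = 0 → x = root x := fun x h =>
    ((hreach x).dist_eq_zero_iff.1 h).symm
  refine ⟨fun x => G.dist (root x) x, fun x y hxy => ?_, fun x hx => ?_, fun x y h hx hy => ?_,
    fun x => ⟨root x, (hreach x).symm, ?_⟩⟩
  · beta_reduce
    rw [hroot' x y hxy.reachable, abs_le]
    have := hxy.diff_dist_adj (u := root y)
    omega
  · obtain ⟨p, hp⟩ := (hreach x).exists_walk_length_eq_dist
    beta_reduce at hx ⊢
    rw [← hp] at hx ⊢
    have hlt : p.length - 1 < p.length := by omega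
    have hadj := p.adj_getVert_succ hlt
    rw [Nat.sub_add_cancel (by omega), p.getVert_length] at hadj
    refine ⟨_, hadj.symm, ?_⟩
    rw [hroot' _ x hadj.reachable]
    have h₁ := SimpleGraph.dist_le (p.take (p.length - 1))
    rw [SimpleGraph.Walk.take_length] at h₁
    have h₂ := hadj.diff_dist_adj (u := root x)
    omega
  · rw [hzero x hx, hzero y hy, hroot' x y h]
  · beta_reduce
    rw [hroot' _ _ (hreach x), SimpleGraph.dist_self]

/-- Forests have orderings in which every vertex has at most one earlier neighbour. -/
lemma exists_parent_ordering {W : Type w} [Finite W] {F : SimpleGraph W} (hF : F.IsAcyclic) :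
    ∃ (π : ℕ → ℕ) (n : ℕ) (e : W → ℕ), (∀ i, π (i + 1) ≤ i) ∧ 2 ≤ n ∧ Function.Injective e ∧
      (∀ x, e x < n) ∧
      ∀ x y, F.Adj x y → (0 < e x ∧ π (e x) = e y) ∨ (0 < e y ∧ π (e y) = e x) := by
  classical
  rcases isEmpty_or_nonempty W with hW | hW
  · exact ⟨fun _ => 0, 2, fun _ => 0, by simp, le_rfl, fun x => hW.elim x, fun x => hW.elim x,
      fun x => hW.elim x⟩
  obtain ⟨T, hFT, -, hT⟩ :=
    (SimpleGraph.connected_top (V := W)).exists_isTree_le_of_le_of_isAcyclic le_top hF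
  obtain ⟨r⟩ := hW
  obtain ⟨N, ⟨idx⟩⟩ := Finite.exists_equiv_fin W
  -- Vertices are ordered by distance to `r` in a tree containing the forest, with ties broken by
  -- `idx`. The only earlier neighbour is then the next vertex on the path to `r`.
  set e : W → ℕ := fun x => T.dist r x * N + idx x with he
  have hdist : ∀ x, e x / N = T.dist r x := by
    intro x
    rw [he]
    dsimp only
    rw [add_comm, Nat.add_mul_div_right _ _ (Fin.pos (idx x)), Nat.div_eq_of_lt (idx x).2, zero_add]
  have hinj : Function.Injective e := by
    intro x y hxy
    have hd : T.dist r x = T.dist r y := by rw [← hdist x, ← hdist y, hxy]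
    simp only [he, hd] at hxy
    exact idx.injective (Fin.ext (by omega))
  have hlt : ∀ x y, e x < e y → T.dist r x ≤ T.dist r y := by
    intro x y hxy
    rw [← hdist x, ← hdist y]
    exact Nat.div_le_div_right hxy.le
  have huniq : ∀ x y z, T.Adj x z → T.Adj y z → e x < e z → e y < e z → x = y := by
    have key : ∀ z, ∃ q, ∀ x, T.Adj x z → e x < e z → x = q := by
      intro z
      obtain ⟨p, hp, -⟩ := hT.connected.exists_path_of_dist r z
      refine ⟨p.penultimate, fun x hxz hlt' => ?_⟩
      have h₁ : T.dist r z = T.dist r x + 1 := by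
        have := hlt x z hlt'
        have := hT.dist_eq_dist_add_one_of_adj r hxz
        omega
      obtain ⟨q, -, hq⟩ := hT.connected.exists_path_of_dist r x
      have hq' : (q.concat hxz).IsPath :=
        SimpleGraph.Walk.isPath_of_length_eq_dist _ (by simp [hq, h₁])
      have := hT.existsUnique_path r z |>.unique hp hq'
      rw [this, SimpleGraph.Walk.penultimate_concat]
    intro x y z hxz hyz hx hy
    obtain ⟨q, hq⟩ := key z
    rw [hq x hxz hx, hq y hyz hy]
  -- Indices without an earlier neighbour, including those outside the range of `e`, are hung from
  -- `0`, so `π` still describes a tree.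
  set π : ℕ → ℕ := fun j => if h : ∃ i, ∃ x y, T.Adj x y ∧ e y = j ∧ e x < e y ∧ i = e x
    then h.choose else 0 with hπ
  have hπe : ∀ x y, T.Adj x y → e x < e y → π (e y) = e x := by
    intro x y hxy hlt'
    have h : ∃ i, ∃ x' y', T.Adj x' y' ∧ e y' = e y ∧ e x' < e y' ∧ i = e x' :=
      ⟨_, x, y, hxy, rfl, hlt', rfl⟩
    rw [hπ]
    dsimp only
    rw [dif_pos h]
    obtain ⟨x', y', hxy', hy', hlt'', hi⟩ := h.choose_spec
    obtain rfl := hinj hy'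
    rw [hi, huniq x x' y' hxy hxy' hlt' hlt'']
  obtain ⟨n, hn⟩ := (Set.finite_range e).bddAbove
  refine ⟨π, n + 2, e, fun i => ?_, by omega, hinj, fun x => ?_, fun x y hxy => ?_⟩
  · rw [hπ]
    dsimp only
    split_ifs with h
    · obtain ⟨x, y, -, hy, hxy, hi⟩ := h.choose_spec
      omega
    · omega
  · have := hn ⟨x, rfl⟩
    omega
  · have hxy' := hFT hxy
    rcases lt_trichotomy (e x) (e y) with h | h | h
    · exact .inr ⟨by omega, hπe x y hxy' h⟩
    · exact absurd (hinj h) hxy.ne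
    · exact .inl ⟨by omega, hπe y x hxy'.symm h⟩

/-- A model of a forest above a layer of a breadth-first layering, all of whose parts meet this
layer, gives a model of the apex-forest. -/
lemma isMinor_of_treeModel {W : Type w} {H : SimpleGraph W} {a : W} {π : ℕ → ℕ} {n : ℕ}
    {e : ({a}ᶜ : Set W) → ℕ} (hπ : ∀ i, π (i + 1) ≤ i) (hn : 2 ≤ n) (he : Function.Injective e)
    (hen : ∀ x, e x < n)
    (hadj : ∀ x y, (H.induce {a}ᶜ).Adj x y →
      (0 < e x ∧ π (e x) = e y) ∨ (0 < e y ∧ π (e y) = e x))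
    {L : V → ℕ} (hL : ∀ x, L x ≠ 0 → ∃ y, G.Adj x y ∧ L y + 1 = L x)
    (hL₀ : ∀ x y, G.Reachable x y → L x = 0 → L y = 0 → x = y)
    (hL₁ : ∀ x, ∃ r, G.Reachable x r ∧ L r = 0)
    {c : ℕ} {M : ℕ → Set V} (hM : IsTreeModel G π n M) (hc : ∀ i < n, ∀ x ∈ M i, c ≤ L x)
    (hc' : ∀ i < n, ∃ x ∈ M i, L x = c) : IsMinor H G := by
  classical
  obtain ⟨n, rfl⟩ : ∃ k, n = k + 1 := ⟨n - 1, by omega⟩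
  have hreach : ∀ i < n + 1, ∀ j < n + 1, ∀ x ∈ M i, ∀ y ∈ M j, G.Reachable x y := by
    intro i hi j hj x hx y hy
    have := (hM.connected_iUnion hπ).preconnected ⟨x, Set.mem_iUnion₂.2 ⟨i, hi, hx⟩⟩
      ⟨y, Set.mem_iUnion₂.2 ⟨j, hj, hy⟩⟩
    exact this.map (SimpleGraph.Embedding.induce _).toHom
  obtain ⟨x₀, hx₀, hx₀c⟩ := hc' 0 (by omega)
  -- At height `0` the component has only its root, which cannot lie in two disjoint parts; this
  -- needs at least two nodes.
  have hcpos : c ≠ 0 := by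
    rintro rfl
    obtain ⟨x₁, hx₁, hx₁c⟩ := hc' 1 (by omega)
    have := hL₀ x₀ x₁ (hreach 0 (by omega) 1 (by omega) x₀ hx₀ x₁ hx₁) hx₀c hx₁c
    exact Set.disjoint_left.1 (hM.disjoint 0 (by omega) 1 (by omega) (by omega)) hx₀ (this ▸ hx₁)
  obtain ⟨r, hr, hr₀⟩ := hL₁ x₀
  -- The branch set of the apex: all vertices of the component below layer `c`. It is connected
  -- because each of them descends to the root, and each part has a vertex in layer `c` with a
  -- neighbour in it.
  set A : Set V := {x | G.Reachable x₀ x ∧ L x < c} with hA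
  have hrA : r ∈ A := ⟨hr, by omega⟩
  have hAconn : (G.induce A).Connected := by
    have key : ∀ l x (hx : x ∈ A), L x = l → (G.induce A).Reachable ⟨x, hx⟩ ⟨r, hrA⟩ := by
      intro l
      induction l with
      | zero =>
        intro x hx hxl
        obtain rfl := hL₀ x r (hx.1.symm.trans hr) hxl hr₀
        exact .refl _
      | succ l ih =>
        intro x hx hxl
        obtain ⟨y, hxy, hy⟩ := hL x (by omega)
        have hyA : y ∈ A := ⟨hx.1.trans hxy.reachable, by have := hx.2; omega⟩
        have hxy' : (G.induce A).Adj ⟨x, hx⟩ ⟨y, hyA⟩ := hxy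
        exact hxy'.reachable.trans (ih y hyA (by omega))
    have : Nonempty A := ⟨⟨r, hrA⟩⟩
    exact ⟨fun x y => (key _ x x.2 rfl).trans (key _ y y.2 rfl).symm⟩
  have hAM : ∀ i < n + 1, Disjoint A (M i) := by
    intro i hi
    rw [Set.disjoint_left]
    intro x hx hx'
    exact absurd (hc i hi x hx') (not_le.2 hx.2)
  have hapex : ∀ i < n + 1, ∃ x ∈ A, ∃ y ∈ M i, G.Adj x y := by
    intro i hi
    obtain ⟨y, hy, hyc⟩ := hc' i hi
    obtain ⟨x, hxy, hx⟩ := hL y (by omega)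
    exact ⟨x, ⟨(hreach 0 (by omega) i hi x₀ hx₀ y hy).trans hxy.reachable, by omega⟩, y, hy,
      hxy.symm⟩
  set B : W → Set V := fun x => if h : x = a then A else M (e ⟨x, h⟩) with hB
  have hBa : B a = A := by simp [hB]
  have hBe : ∀ x (h : x ≠ a), B x = M (e ⟨x, h⟩) := fun x h => by simp [hB, h]
  refine ⟨B, fun x => ?_, fun x y hxy => ?_, fun x y hxy => ?_⟩
  · by_cases hx : x = a
    · rw [hx, hBa]
      exact hAconn
    · rw [hBe x hx]
      exact hM.connected _ (hen _)
  · by_cases hx : x = a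
    · subst hx
      rw [hBa, hBe y hxy.symm]
      exact hAM _ (hen _)
    · by_cases hy : y = a
      · subst hy
        rw [hBa, hBe x hx]
        exact (hAM _ (hen _)).symm
      · rw [hBe x hx, hBe y hy]
        exact hM.disjoint _ (hen _) _ (hen _) fun h => hxy (congrArg Subtype.val (he h))
  · have hMadj : ∀ i j, i < n + 1 → 0 < i → π i = j → ∃ x ∈ M i, ∃ y ∈ M j, G.Adj x y := by
      rintro i _ hi hi₀ rfl
      obtain ⟨i, rfl⟩ := Nat.exists_eq_succ_of_ne_zero hi₀.ne'
      exact hM.adj i hi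
    by_cases hx : x = a
    · subst hx
      rw [hBa, hBe y hxy.ne']
      exact hapex _ (hen _)
    · by_cases hy : y = a
      · subst hy
        rw [hBa, hBe x hx]
        obtain ⟨z, hz, z', hz', hzz'⟩ := hapex _ (hen ⟨x, hx⟩)
        exact ⟨z', hz', z, hz, hzz'.symm⟩
      · rw [hBe x hx, hBe y hy]
        rcases hadj ⟨x, hx⟩ ⟨y, hy⟩ hxy with ⟨h₀, h⟩ | ⟨h₀, h⟩
        · exact hMadj _ _ (hen _) h₀ h
        · obtain ⟨z, hz, z', hz', hzz'⟩ := hMadj _ _ (hen _) h₀ h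
          exact ⟨z', hz', z, hz, hzz'.symm⟩

theorem asdim_minorFreeClass_le_two {W : Type w} [Finite W] {H : SimpleGraph W}
    (hH : IsApexForest H) : asdim.{u} (minorFreeClass.{u, w} H) ≤ 2 := by
  obtain ⟨a, ha⟩ := hH
  obtain ⟨π, n, e, hπ, hn, he, hen, hadj⟩ := exists_parent_ordering ha
  choose κ m hκ _ hmodel using exists_tree_forall_model.{u} π hπ (by omega : 0 < n)
  refine asdim_le_two_of_layering (fun w => m w + 1) fun V G ⟨hV, hG⟩ => ?_
  obtain ⟨L, hL, hL₁, hL₂, hL₃⟩ := exists_bfs_layering G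
  refine ⟨L, hL, fun w b => ?_⟩
  rcases sweepable_or_exists_treeModel (G.induce {x | b ≤ L x ∧ L x ≤ b + w}) (hκ w) (m w)
    with h | ⟨M, hM⟩
  · exact h.exists_pathBags
  · refine absurd ?_ hG
    obtain ⟨c, M', hM', hc, hc'⟩ := hmodel w V G L b _ hM.of_induce (by
      rintro i - _ ⟨x, -, rfl⟩
      exact x.2)
    exact isMinor_of_treeModel hπ hn he hen hadj hL₁ hL₂ hL₃ hM' hc hc'

/-! ### Layered pathwidth and the conclusion -/

/-- A discrete intermediate value argument: steps in a path change the index by one. It turns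
connected node sets into intervals. -/
lemma mem_of_walk_induce_pathGraph {m : ℕ} {s : Set (Fin m)} {i k : s}
    (p : ((SimpleGraph.pathGraph m).induce s).Walk i k) {j : Fin m} (hij : i.1 ≤ j)
    (hjk : j ≤ k.1) : j ∈ s := by
  induction p with
  | nil => exact le_antisymm hij hjk ▸ Subtype.property _
  | @cons x y z h p ih =>
    by_cases hxj : x.1 = j
    · exact hxj ▸ x.2
    · refine ih ?_ hjk
      have h' : (SimpleGraph.pathGraph m).Adj x.1 y.1 := h
      rw [SimpleGraph.pathGraph_adj] at h'
      rw [Fin.le_def] at *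
      have : x.1.1 ≠ j.1 := fun h => hxj (Fin.ext h)
      omega

lemma encard_inter_annulus_le {B : Set V} {L : V → ℕ} {k : ℕ}
    (hk : ∀ j, (B ∩ {x | L x = j}).encard ≤ (k : ℕ∞)) (a w : ℕ) :
    (B ∩ {x | a ≤ L x ∧ L x ≤ a + w}).encard ≤ ((k * (w + 1) : ℕ) : ℕ∞) := by
  induction w with
  | zero =>
    refine (Set.encard_le_encard ?_).trans ((hk a).trans (by simp))
    rintro x ⟨hx, h₁, h₂⟩
    exact ⟨hx, le_antisymm h₂ h₁⟩
  | succ w ih =>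
    have hsub : B ∩ {x | a ≤ L x ∧ L x ≤ a + (w + 1)} ⊆
        (B ∩ {x | a ≤ L x ∧ L x ≤ a + w}) ∪ (B ∩ {x | L x = a + (w + 1)}) := by
      rintro x ⟨hx, h₁, h₂⟩
      rcases Nat.lt_or_ge (a + w) (L x) with h | h
      · exact .inr ⟨hx, le_antisymm h₂ h⟩
      · exact .inl ⟨hx, h₁, h⟩
    refine (Set.encard_le_encard hsub).trans ((Set.encard_union_le _ _).trans
      ((add_le_add ih (hk _)).trans ?_))
    rw [← Nat.cast_add]
    exact_mod_cast (by ring_nf; rfl : k * (w + 1) + k ≤ k * (w + 1 + 1))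

theorem asdim_layeredPathwidthClass_le_two (k : ℕ) :
    asdim.{u} (layeredPathwidthClass.{u} k) ≤ 2 := by
  refine asdim_le_two_of_layering (fun w => k * (w + 1)) ?_
  rintro V G ⟨-, m, B, L, hB, hL, hk⟩
  -- The bags are restricted to the annulus and continued by empty bags from index `m` on.
  refine ⟨L, hL, fun w a => ⟨fun i => {x | ∃ h : i < m, x.1 ∈ B ⟨i, h⟩}, ?_, ?_, ?_, ?_, ?_⟩⟩
  · rintro i j l x hij hjl ⟨hi, hxi⟩ ⟨hl, hxl⟩
    have hj : j < m := by omega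
    obtain ⟨p⟩ := (hB.subtree x.1).connected.preconnected ⟨⟨i, hi⟩, hxi⟩ ⟨⟨l, hl⟩, hxl⟩
    exact ⟨hj, mem_of_walk_induce_pathGraph p (j := ⟨j, hj⟩) hij hjl⟩
  · intro x y hxy
    obtain ⟨i, hx, hy⟩ := hB.edge _ _ hxy
    exact ⟨i, ⟨i.2, hx⟩, ⟨i.2, hy⟩⟩
  · intro x
    obtain ⟨⟨i, hi⟩⟩ := (hB.subtree x.1).connected.nonempty
    exact ⟨i, i.2, hi⟩
  · exact ⟨m, fun i x hx => hx.1.le⟩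
  · intro i
    rw [← Subtype.val_injective.encard_image]
    by_cases hi : i < m
    · refine (Set.encard_le_encard ?_).trans (encard_inter_annulus_le (hk ⟨i, hi⟩) a w)
      rintro _ ⟨x, ⟨_, hx⟩, rfl⟩
      exact ⟨hx, x.2⟩
    · refine (Set.encard_le_encard (t := ∅) ?_).trans (by simp)
      rintro _ ⟨x, ⟨h, _⟩, rfl⟩
      exact absurd h hi

end Asdim

theorem corollary7p6 :
    (∀ k : ℕ, Asdim.asdim.{u} (Asdim.layeredPathwidthClass.{u} k) ≤ 2) ∧
    (∀ (W : Type w) [Finite W] (H : SimpleGraph W), Asdim.IsApexForest H →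
      Asdim.asdim.{u} (Asdim.minorFreeClass.{u, w} H) ≤ 2) :=
  ⟨Asdim.asdim_layeredPathwidthClass_le_two,
    fun _ _ _ hH => Asdim.asdim_minorFreeClass_le_two hH⟩
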